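/- Let $A$ be a separable simple $C^*$-algebra (no nontrivial closed two-sided ideals), let $\mathcal K$ be the compact operators on a separable infinite-dimensional Hilbert space, and let $\mathrm{Ped}(A\otimes\mathcal K)$ be the Pedersen ideal (the smallest dense two-sided ideal) of $A\otimes\mathcal K$. Let $\widetilde T$ be the cone of densely defined traces on $A\otimes\mathcal K$, i.e. of positive linear functionals $\tau$ on $\mathrm{Ped}(A\otimes\mathcal K)$ with $\tau(xy)=\tau(yx)$, with the topology of pointwise convergence on $\mathrm{Ped}(A\otimes\mathcal K)$; assume $\widetilde T\ne\{0\}$. A basis of $\widetilde T$ is a convex set $S\subset\widetilde T\setminus\{0\}$ such that each $t\in\widetilde T\setminus\{0\}$ is $t=rs$ for a unique pair $r\in\mathbb R_+$, $s\in S$. A Choquet simplex is a metrizable compact convex set $T$ (in a locally convex space) such that the cone over $T$ is a lattice in its own order; it is a Bauer simplex if its extremal boundary $\partial_e(T)$ is compact. For a Borel set $K\subset\partial_e(T)$ let $M_K\subset T$ be the set of barycenters of the Borel probability measures on $\partial_e(T)$ that are concentrated on $K$. A Choquet simplex $T$ satisfies condition (C) if $\partial_e(T)=\bigcup_{n\ge1}X_n$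 with compact sets $X_n$ of finite covering dimension such that for all $k,m\ge1$, with $K=\bigcup_{j=1}^m X_{j+k}$, one has $\overline{\mathrm{conv}(K)}=M_K$ and $\overline{\mathrm{conv}(\partial_e(T)\setminus K)}=M_{\partial_e(T)\setminus K}$. Let $S\subset\widetilde T\setminus\{0\}$ be a Choquet simplex that is a basis of $\widetilde T$, let $e\in\mathrm{Ped}(A\otimes\mathcal K)\setminus\{0\}$ with $0\le e\le1$, and let $T_e=\{\tau\in\widetilde T:\tau(e)=1\}$. Then $T_e$ is a Choquet simplex and a basis of $\widetilde T$, and: (1) The map $\gamma(\tau)=\tau/\tau(e)$ is a homeomorphism (not required to be affine) from $S$ onto $T_e$ that maps $\partial_e(S)$ onto $\partial_e(T_e)$. (2) $S$ satisfies condition (C) if and only if $T_e$ does. Consequently, if $S'$ is any other basis of $\widetilde T$ that is a Choquet simplex, then $S$ satisfies condition (C) if and only if $S'$ does. (3) If $S$ is a Bauer simplex, then so is $T_e$, and there is an affine homeomorphism $\gamma:S\to T_e$ such that $\gamma(\tau)(a)=\tau(a)/\tau(e)$ for all $a\in\mathrm{Ped}(A\otimes\mathcal K)$ and all $\tau\in\partial_e(S)$.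 -/

import Mathlib

open scoped ComplexOrder ENNReal

universe u v

namespace TraceCone

section Simplex

variable {E : Type v} [AddCommGroup E] [Module ℝ E] [TopologicalSpace E]

/-- The cone `{(α x, α) : α ≥ 0, x ∈ K}` in `E × ℝ` over a set `K`. -/
def coneOver (K : Set E) : Set (E × ℝ) :=
  {p | ∃ α : ℝ, 0 ≤ α ∧ ∃ x ∈ K, p = (α • x, α)}

/-- A set `P` is a lattice for the relation `p ≤ q ↔ q - p ∈ P`: any two elements of `P` have a
least upper bound in `P`. (For a convex cone `P` greatest lower bounds are then given by
`p + q - p ⊔ q`.) -/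
def IsLatticeCone {F : Type v} [AddCommGroup F] (P : Set F) : Prop :=
  ∀ p ∈ P, ∀ q ∈ P, ∃ r ∈ P, r - p ∈ P ∧ r - q ∈ P ∧
    ∀ w ∈ P, w - p ∈ P → w - q ∈ P → w - r ∈ P

/-- A (metrizable) Choquet simplex: a metrizable compact convex set such that the cone over it is
a lattice. -/
structure IsChoquetSimplex (T : Set E) : Prop where
  isCompact : IsCompact T
  convex : Convex ℝ T
  metrizable : TopologicalSpace.MetrizableSpace T
  lattice : IsLatticeCone (coneOver T)

/-- A Bauer simplex: a Choquet simplex whose extremal boundary is compact. -/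
structure IsBauerSimplex (T : Set E) : Prop extends IsChoquetSimplex T where
  isCompact_extremePoints : IsCompact (T.extremePoints ℝ)

/-- `f` restricts to a continuous real affine function on the convex set `T`, i.e. to an element
of `Aff(T)`. -/
def IsContAffineOn (T : Set E) (f : E → ℝ) : Prop :=
  ContinuousOn f T ∧ ∀ x ∈ T, ∀ y ∈ T, ∀ a b : ℝ, 0 ≤ a → 0 ≤ b → a + b = 1 →
    f (a • x + b • y) = a * f x + b * f y

/-- `μ` is a Borel probability measure on the extremal boundary of `T` with barycenter `t`. -/
def IsBoundaryMeasure (T : Set E) (t : E)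
    (μ : @MeasureTheory.Measure (T.extremePoints ℝ) (borel (T.extremePoints ℝ))) : Prop :=
  MeasureTheory.IsProbabilityMeasure μ ∧
    ∀ f : E → ℝ, IsContAffineOn T f → ∫ x, f (x : E) ∂μ = f t

/-- `M_K`, for a Borel subset `K` of the extremal boundary of `T`: the points of `T` that are
represented by a Borel probability measure on the extremal boundary which is concentrated
on `K`. -/
def concentratedOn (T K : Set E) : Set E :=
  {t | t ∈ T ∧
    ∃ μ : @MeasureTheory.Measure (T.extremePoints ℝ) (borel (T.extremePoints ℝ)),
      IsBoundaryMeasure T t μ ∧ μ {x | (x : E) ∉ K} = 0}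

end Simplex

/-- Lebesgue covering dimension at most `n`: every finite open cover has a finite open refinement
such that no point lies in more than `n + 1` of its members. -/
def CoveringDimLE (X : Type v) [TopologicalSpace X] (n : ℕ) : Prop :=
  ∀ U : Set (Set X), U.Finite → (∀ u ∈ U, IsOpen u) → ⋃₀ U = Set.univ →
    ∃ V : Set (Set X), V.Finite ∧ (∀ w ∈ V, IsOpen w) ∧ ⋃₀ V = Set.univ ∧
      (∀ w ∈ V, ∃ u ∈ U, w ⊆ u) ∧ ∀ x : X, {w ∈ V | x ∈ w}.ncard ≤ n + 1

/-- Condition (C) for a Choquet simplex `T`: its extremal boundary is a countable union of compact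
sets `X 1, X 2, …` of finite covering dimension such that, for all `k, m ≥ 1`, with
`K = ⋃_{1 ≤ j ≤ m} X (j + k)`, the closed convex hulls of `K` and of its complement in the extremal
boundary are `M_K` and `M_{∂ₑT \ K}`. -/
def ConditionC {E : Type v} [AddCommGroup E] [Module ℝ E] [TopologicalSpace E] (T : Set E) :
    Prop :=
  ∃ X : ℕ+ → Set E,
    (∀ n, IsCompact (X n) ∧ ∃ d : ℕ, CoveringDimLE (X n) d) ∧
    T.extremePoints ℝ = ⋃ n, X n ∧
    ∀ k m : ℕ+,
      closure (convexHull ℝ (⋃ j ∈ Set.Icc 1 m, X (j + k))) =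
        concentratedOn T (⋃ j ∈ Set.Icc 1 m, X (j + k)) ∧
      closure (convexHull ℝ (T.extremePoints ℝ \ ⋃ j ∈ Set.Icc 1 m, X (j + k))) =
        concentratedOn T (T.extremePoints ℝ \ ⋃ j ∈ Set.Icc 1 m, X (j + k))

section Algebra

variable (B : Type u) [NonUnitalCStarAlgebra B]

variable {B} in
/-- A two-sided (not necessarily closed) ideal. -/
def IsIdeal (I : Submodule ℂ B) : Prop :=
  ∀ x : B, ∀ y ∈ I, x * y ∈ I ∧ y * x ∈ I

/-- Simplicity as a C⋆-algebra: there are no nontrivial closed two-sided ideals. -/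
def IsSimple : Prop :=
  ∀ I : Submodule ℂ B, IsIdeal I → IsClosed (I : Set B) → I = ⊥ ∨ I = ⊤

/-- The Pedersen ideal: the smallest dense two-sided ideal. -/
def ped : Submodule ℂ B :=
  sInf {I | IsIdeal I ∧ Dense (I : Set B)}

variable {B} in
theorem ped_isIdeal : IsIdeal (ped B) := by
  intro x y hy
  rw [ped, Submodule.mem_sInf] at hy
  simp only [ped, Submodule.mem_sInf]
  exact ⟨fun I hI => (hI.1 x y (hy I hI)).1, fun I hI => (hI.1 x y (hy I hI)).2⟩

/-- The Pedersen ideal is closed under multiplication. -/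
instance pedMul : Mul (ped B) := ⟨fun x y => ⟨(x : B) * y, (ped_isIdeal (x : B) y y.2).1⟩⟩

variable {B} in
/-- Positive elements of a C⋆-algebra. -/
def IsPos (x : B) : Prop := ∃ y : B, x = star y * y

/-- The cone of densely defined traces on `B`: positive linear functionals on the Pedersen ideal
with the trace property. It carries the topology of pointwise convergence on the Pedersen ideal,
as a subset of the product space `ped B → ℂ`. -/
def traces : Set (ped B → ℂ) :=
  {τ | IsLinearMap ℂ τ ∧ (∀ x : ped B, IsPos (x : B) → 0 ≤ τ x) ∧
    ∀ x y : ped B, τ (x * y) = τ (y * x)}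

variable {B}

/-- `S` is a basis of the cone of traces. -/
def IsTraceBasis (S : Set (ped B → ℂ)) : Prop :=
  S ⊆ traces B \ {0} ∧ Convex ℝ S ∧
    ∀ t ∈ traces B \ {0}, ∃! p : ℝ × (ped B → ℂ), 0 ≤ p.1 ∧ p.2 ∈ S ∧ p.1 • p.2 = t

/-- The set `T_e` of the traces normalized at `e`. -/
def tracesAt (e : ped B) : Set (ped B → ℂ) :=
  {τ | τ ∈ traces B ∧ τ e = 1}

end Algebra

section Stabilization

variable (A : Type u) [NonUnitalCStarAlgebra A] [PartialOrder A] [StarOrderedRing A]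

/-- The Hilbert space of the universal representation of `A`: the Hilbert sum of the GNS spaces of
all positive linear functionals on `A`. -/
abbrev UnivSpace : Type u := lp (fun f : A →ₚ[ℂ] ℂ => f.GNS) 2

variable {A} in
/-- The universal representation of `A`, the direct sum of all GNS representations (it is faithful,
by the Gelfand-Naimark theorem). -/
noncomputable def univRep (a : A) : UnivSpace A →L[ℂ] UnivSpace A :=
  lp.mapCLM 2 (fun f : A →ₚ[ℂ] ℂ => f.gnsNonUnitalStarAlgHom a) (norm_nonneg a)
    (fun f => NonUnitalStarAlgHom.norm_apply_le f.gnsNonUnitalStarAlgHom a)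

/-- The Hilbert space `ℓ²(ℕ, H) = H ⊗ ℓ²(ℕ)` for the space `H` of the universal representation. -/
abbrev AmplifiedSpace : Type u := lp (fun _ : ℕ => UnivSpace A) 2

variable {A} in
/-- The elementary tensor `a ⊗ e_{i,j}`, acting on `H ⊗ ℓ²(ℕ)`: it maps `(ξ_k)_k` to the sequence
with `a ξ_j` in position `i` and `0` elsewhere. -/
noncomputable def tensorUnit (a : A) (i j : ℕ) : AmplifiedSpace A →L[ℂ] AmplifiedSpace A :=
  (lp.singleContinuousLinearMap ℂ (fun _ : ℕ => UnivSpace A) 2 i).comp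
    ((univRep a).comp (lp.evalCLM ℂ (fun _ : ℕ => UnivSpace A) 2 j))

/-- The C⋆-tensor product `A ⊗ 𝒦` as a closed ⋆-subalgebra of the bounded operators on `H ⊗ ℓ²(ℕ)`.
Since the algebra `𝒦` of compact operators on `ℓ²(ℕ)` is the closed linear span of the matrix units
`e_{i,j}`, it is generated by the elements `a ⊗ e_{i,j}`. -/
noncomputable def stabSubalgebra :
    NonUnitalStarSubalgebra ℂ (AmplifiedSpace A →L[ℂ] AmplifiedSpace A) :=
  (NonUnitalStarAlgebra.adjoin ℂ
    {T | ∃ (a : A) (i j : ℕ), T = tensorUnit a i j}).topologicalClosure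

/-- The stabilization `A ⊗ 𝒦`. -/
def Stab : Type u := stabSubalgebra A

noncomputable instance stabCStarAlgebra : NonUnitalCStarAlgebra (Stab A) :=
  NonUnitalStarSubalgebra.nonUnitalCStarAlgebra (stabSubalgebra A)
    (h_closed := NonUnitalStarSubalgebra.isClosed_topologicalClosure _)

end Stabilization

end TraceCone

/-! The bases `S` and `T_e` are two sections of one cone, and everything follows from the central
projection `x ↦ (g x)⁻¹ • x` between them, where `g τ = τ(e)`.

The projection exists because `A ⊗ 𝒦` is simple: a trace that vanishes at one nonzero positive
element of the Pedersen ideal is zero (`trace_eq_zero`), so `g` is strictly positive on nonzero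
traces. As `S` is compact, the projection is a homeomorphism, and the scaling function `h` of its
inverse is again positive, continuous and affine. This symmetric situation is recorded as
`IsPerspective`.

The projection is not affine, but it maps segments to segments and only changes the weights. Hence
it preserves extreme points, convex hulls and their closures. The cones over the two sections are
isomorphic by a map that changes only the height coordinate, so the lattice property passes over. A
boundary measure `μ` representing `t` becomes the image of `(g / g t) μ`, which has no new null-set
obstructions, so the sets `M_K` correspond as well. This gives condition (C), and any two bases are
compared through `T_e`.

For a Bauer simplex, continuous functions on the extremal boundary extend to continuous affine
functions: Riesz decomposition in the cone gives interpolation, interpolation and compactness give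
affine functions close to maxima, and the lattice form of Stone-Weierstrass gives density. Extending
the boundary homeomorphism and its inverse coordinatewise yields the affine homeomorphism. -/

namespace TraceCone

/-! ### Central projection between two sections of a cone. -/

section Perspective

open MeasureTheory

variable {E : Type v} [AddCommGroup E] [Module ℝ E]

/-- A map that is additive on `P` and inverse to an additive map on `Q` carries the lattice
property of `P` to `Q`. -/
theorem IsLatticeCone.of_additive {F : Type v} [AddCommGroup F] {P Q : Set F} {Φ Ψ : F → F}
    (hΦ : ∀ p ∈ P, Φ p ∈ Q) (hΨ : ∀ q ∈ Q, Ψ q ∈ P) (hΦΨ : ∀ q ∈ Q, Φ (Ψ q) = q)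
    (addΦ : ∀ p ∈ P, ∀ q ∈ P, Φ (p + q) = Φ p + Φ q)
    (addΨ : ∀ p ∈ Q, ∀ q ∈ Q, Ψ (p + q) = Ψ p + Ψ q) (hP : IsLatticeCone P) :
    IsLatticeCone Q := by
  -- Additivity on the cone is enough for monotonicity, since `q = p + (q - p)` with both summands
  -- in `P`.
  have mono : ∀ p ∈ P, ∀ q ∈ P, q - p ∈ P → Φ q - Φ p ∈ Q := by
    intro p hp q hq h
    have := addΦ p hp _ h
    rw [add_sub_cancel] at this
    rw [this, add_sub_cancel_left]
    exact hΦ _ h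
  have mono' : ∀ p ∈ Q, ∀ q ∈ Q, q - p ∈ Q → Ψ q - Ψ p ∈ P := by
    intro p hp q hq h
    have := addΨ p hp _ h
    rw [add_sub_cancel] at this
    rw [this, add_sub_cancel_left]
    exact hΨ _ h
  intro p hp q hq
  obtain ⟨r, hr, h1, h2, h3⟩ := hP _ (hΨ p hp) _ (hΨ q hq)
  refine ⟨Φ r, hΦ r hr, ?_, ?_, ?_⟩
  · simpa [hΦΨ p hp] using mono _ (hΨ p hp) _ hr h1
  · simpa [hΦΨ q hq] using mono _ (hΨ q hq) _ hr h2
  · intro w hw hwp hwq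
    have := mono _ hr _ (hΨ w hw)
      (h3 _ (hΨ w hw) (mono' _ hp _ hw hwp) (mono' _ hq _ hw hwq))
    simpa [hΦΨ w hw] using this

theorem add_mem_coneOver {K : Set E} (hK : Convex ℝ K) {p q : E × ℝ} (hp : p ∈ coneOver K)
    (hq : q ∈ coneOver K) : p + q ∈ coneOver K := by
  obtain ⟨α, hα, x, hx, rfl⟩ := hp
  obtain ⟨β, hβ, y, hy, rfl⟩ := hq
  rcases (add_nonneg hα hβ).eq_or_lt with h | h
  · have h1 : α = 0 := by linarith
    have h2 : β = 0 := by linarith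
    exact ⟨0, le_rfl, x, hx, by simp [h1, h2]⟩
  · refine ⟨α + β, h.le, (α / (α + β)) • x + (β / (α + β)) • y,
      hK hx hy (by positivity) (by positivity) (by field_simp), ?_⟩
    rw [smul_add, smul_smul, smul_smul, mul_div_cancel₀ _ h.ne', mul_div_cancel₀ _ h.ne']
    rfl

variable [TopologicalSpace E]

/-- The convex sets `S` and `T` are bases of the same cone: they correspond to each other under
rescaling by the positive continuous affine functions `g` and `h`. -/
structure IsPerspective (S T : Set E) (g h : E → ℝ) : Prop where
  convex_left : Convex ℝ S
  convex_right : Convex ℝ T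
  pos_left : ∀ x ∈ S, 0 < g x
  pos_right : ∀ y ∈ T, 0 < h y
  affine_left : IsContAffineOn S g
  affine_right : IsContAffineOn T h
  mapsTo_left : ∀ x ∈ S, (g x)⁻¹ • x ∈ T
  mapsTo_right : ∀ y ∈ T, (h y)⁻¹ • y ∈ S
  apply_left : ∀ x ∈ S, h ((g x)⁻¹ • x) = (g x)⁻¹
  apply_right : ∀ y ∈ T, g ((h y)⁻¹ • y) = (h y)⁻¹

namespace IsPerspective

variable {S T : Set E} {g h : E → ℝ}

theorem symm (H : IsPerspective S T g h) : IsPerspective T S h g :=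
  ⟨H.2, H.1, H.4, H.3, H.6, H.5, H.8, H.7, H.10, H.9⟩

theorem left_inv (H : IsPerspective S T g h) {x : E} (hx : x ∈ S) :
    (h ((g x)⁻¹ • x))⁻¹ • (g x)⁻¹ • x = x := by
  rw [H.apply_left x hx, inv_inv, smul_inv_smul₀ (H.pos_left x hx).ne']

/-- Rescaling of an affine function on `T` to one on `S`. -/
theorem isContAffineOn_mul [ContinuousSMul ℝ E] (H : IsPerspective S T g h) {f : E → ℝ}
    (hf : IsContAffineOn T f) : IsContAffineOn S fun x => g x * f ((g x)⁻¹ • x) := by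
  constructor
  · refine H.affine_left.1.mul (hf.1.comp ?_ H.mapsTo_left)
    exact (H.affine_left.1.inv₀ fun x hx => (H.pos_left x hx).ne').smul continuousOn_id
  · intro x hx y hy a b ha hb hab
    have hz := H.convex_left hx hy ha hb hab
    have gz := H.pos_left _ hz
    have gx := H.pos_left _ hx
    have gy := H.pos_left _ hy
    have e := H.affine_left.2 x hx y hy a b ha hb hab
    -- With `z = a • x + b • y`, the weights `a g(x) / g(z)` and `b g(y) / g(z)` express `(g z)⁻¹ •
    -- z` through the projected endpoints; they sum to 1 because `g` is affine.
    have key := hf.2 _ (H.mapsTo_left x hx) _ (H.mapsTo_left y hy)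
      (a * g x / g (a • x + b • y)) (b * g y / g (a • x + b • y)) (by positivity) (by positivity)
      (by rw [← add_div, ← e, div_self gz.ne'])
    have h1 : (a * g x / g (a • x + b • y)) • (g x)⁻¹ • x +
        (b * g y / g (a • x + b • y)) • (g y)⁻¹ • y =
        (g (a • x + b • y))⁻¹ • (a • x + b • y) := by
      rw [smul_add, smul_smul, smul_smul, smul_smul, smul_smul]
      congr 2 <;> field_simp
    rw [h1] at key
    simp only
    rw [key]
    field_simp

/-- The correspondence maps open segments into open segments. -/
theorem mem_openSegment (H : IsPerspective S T g h) {x y z : E} (hx : x ∈ S) (hy : y ∈ S)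
    (hz : z ∈ openSegment ℝ x y) :
    (g z)⁻¹ • z ∈ openSegment ℝ ((g x)⁻¹ • x) ((g y)⁻¹ • y) := by
  obtain ⟨a, b, ha, hb, hab, rfl⟩ := hz
  have gz := H.pos_left _ (H.convex_left hx hy ha.le hb.le hab)
  have gx := H.pos_left _ hx
  have gy := H.pos_left _ hy
  refine ⟨a * g x / g (a • x + b • y), b * g y / g (a • x + b • y), by positivity, by positivity,
    ?_, ?_⟩
  · rw [← add_div, ← H.affine_left.2 x hx y hy a b ha.le hb.le hab, div_self gz.ne']
  · rw [smul_add, smul_smul, smul_smul, smul_smul, smul_smul]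
    congr 2 <;> field_simp

/-- The inverse projection sends an open segment through the image point to an open segment through
`x`, which collapses by extremality. -/
theorem mem_extremePoints (H : IsPerspective S T g h) {x : E} (hx : x ∈ S.extremePoints ℝ) :
    (g x)⁻¹ • x ∈ T.extremePoints ℝ := by
  refine ⟨H.mapsTo_left x hx.1, fun y₁ h₁ y₂ h₂ hs => ?_⟩
  have h3 := H.symm.mem_openSegment h₁ h₂ hs
  rw [H.left_inv hx.1] at h3
  have h4 := hx.2 (H.mapsTo_right _ h₁) (H.mapsTo_right _ h₂) h3
  rw [← h4, H.symm.left_inv h₁]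

theorem image_subset (H : IsPerspective S T g h) : (fun x => (g x)⁻¹ • x) '' S ⊆ T :=
  Set.image_subset_iff.2 H.mapsTo_left

theorem image_image (H : IsPerspective S T g h) {K : Set E} (hK : K ⊆ S) :
    (fun y => (h y)⁻¹ • y) '' ((fun x => (g x)⁻¹ • x) '' K) = K := by
  rw [Set.image_image]
  ext x
  constructor
  · rintro ⟨y, hy, rfl⟩
    simp only
    rwa [H.left_inv (hK hy)]
  · exact fun hx => ⟨x, hx, H.left_inv (hK hx)⟩

theorem image_extremePoints (H : IsPerspective S T g h) :
    (fun x => (g x)⁻¹ • x) '' S.extremePoints ℝ = T.extremePoints ℝ := by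
  refine Set.Subset.antisymm (Set.image_subset_iff.2 fun x hx => H.mem_extremePoints hx)
    fun y hy => ?_
  exact ⟨_, H.symm.mem_extremePoints hy, H.symm.left_inv hy.1⟩

theorem injOn (H : IsPerspective S T g h) : Set.InjOn (fun x => (g x)⁻¹ • x) S := by
  intro x hx y hy hxy
  rw [← H.left_inv hx, ← H.left_inv hy]
  simp only at hxy
  rw [hxy]

theorem image_diff (H : IsPerspective S T g h) {K : Set E} (hK : K ⊆ S) :
    (fun x => (g x)⁻¹ • x) '' (S.extremePoints ℝ \ K) =
      T.extremePoints ℝ \ (fun x => (g x)⁻¹ • x) '' K := by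
  rw [← H.image_extremePoints]
  refine Set.Subset.antisymm ?_ ?_
  swap
  · rintro _ ⟨⟨x, hx, rfl⟩, hxK⟩
    exact ⟨x, ⟨hx, fun h => hxK ⟨x, h, rfl⟩⟩, rfl⟩
  rintro _ ⟨x, ⟨hx, hxK⟩, rfl⟩
  refine ⟨⟨x, hx, rfl⟩, ?_⟩
  rintro ⟨z, hz, hzx⟩
  exact hxK (H.injOn (hK hz) hx.1 hzx ▸ hz)
  
theorem continuousOn [ContinuousSMul ℝ E] (H : IsPerspective S T g h) :
    ContinuousOn (fun x => (g x)⁻¹ • x) S :=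
  (H.affine_left.1.inv₀ fun x hx => (H.pos_left x hx).ne').smul continuousOn_id

/-- The correspondence as a homeomorphism. -/
noncomputable def homeomorph [ContinuousSMul ℝ E] (H : IsPerspective S T g h) : S ≃ₜ T where
  toFun x := ⟨(g x)⁻¹ • (x : E), H.mapsTo_left x x.2⟩
  invFun y := ⟨(h y)⁻¹ • (y : E), H.mapsTo_right y y.2⟩
  left_inv x := Subtype.ext (H.left_inv x.2)
  right_inv y := Subtype.ext (H.symm.left_inv y.2)
  continuous_toFun := (continuousOn_iff_continuous_domRestrict.1 H.continuousOn).subtype_mk _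
  continuous_invFun := (continuousOn_iff_continuous_domRestrict.1 H.symm.continuousOn).subtype_mk _

/-- The correspondence as a homeomorphism of the extremal boundaries. -/
noncomputable def extremeHomeomorph [ContinuousSMul ℝ E] (H : IsPerspective S T g h) :
    S.extremePoints ℝ ≃ₜ T.extremePoints ℝ where
  toFun x := ⟨(g x)⁻¹ • (x : E), H.mem_extremePoints x.2⟩
  invFun y := ⟨(h y)⁻¹ • (y : E), H.symm.mem_extremePoints y.2⟩
  left_inv x := Subtype.ext (H.left_inv x.2.1)
  right_inv y := Subtype.ext (H.symm.left_inv y.2.1)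
  continuous_toFun := (continuousOn_iff_continuous_domRestrict.1
    (H.continuousOn.mono extremePoints_subset)).subtype_mk _
  continuous_invFun := (continuousOn_iff_continuous_domRestrict.1
    (H.symm.continuousOn.mono extremePoints_subset)).subtype_mk _

/-- The correspondence of the cones over `S` and `T`. -/
theorem coneOver_mapsTo (H : IsPerspective S T g h) {p : E × ℝ} (hp : p ∈ coneOver S) :
    (p.1, p.2 * g (p.2⁻¹ • p.1)) ∈ coneOver T := by
  obtain ⟨α, hα, x, hx, rfl⟩ := hp
  rcases hα.eq_or_lt with rfl | h0
  · exact ⟨0, le_rfl, _, H.mapsTo_left x hx, by simp⟩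
  · have gx := H.pos_left x hx
    refine ⟨α * g x, by positivity, _, H.mapsTo_left x hx, ?_⟩
    simp only [inv_smul_smul₀ h0.ne', mul_smul, smul_inv_smul₀ gx.ne']

theorem coneOver_left_inv (H : IsPerspective S T g h) {p : E × ℝ} (hp : p ∈ coneOver S) :
    (p.1, (p.2 * g (p.2⁻¹ • p.1)) * h ((p.2 * g (p.2⁻¹ • p.1))⁻¹ • p.1)) = p := by
  obtain ⟨α, hα, x, hx, rfl⟩ := hp
  rcases hα.eq_or_lt with rfl | h0
  · simp
  · have gx := H.pos_left x hx
    simp only [inv_smul_smul₀ h0.ne', mul_inv_rev, mul_smul, H.apply_left x hx]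
    congr 1
    field_simp

/-- The new height `p.2 * g (p.2⁻¹ • p.1)` is the homogeneous extension of `g` to the cone, and
affinity of `g` turns into additivity. At the apex the factor `p.2 = 0` makes the value of `g`
irrelevant. -/
theorem coneOver_add (H : IsPerspective S T g h) {p q : E × ℝ} (hp : p ∈ coneOver S)
    (hq : q ∈ coneOver S) :
    (((p + q).1, (p + q).2 * g ((p + q).2⁻¹ • (p + q).1)) : E × ℝ) =
      (p.1, p.2 * g (p.2⁻¹ • p.1)) + (q.1, q.2 * g (q.2⁻¹ • q.1)) := by
  obtain ⟨α, hα, x, hx, rfl⟩ := hp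
  obtain ⟨β, hβ, y, hy, rfl⟩ := hq
  rcases hα.eq_or_lt with rfl | hα
  · simp
  rcases hβ.eq_or_lt with rfl | hβ
  · simp
  have key := H.affine_left.2 x hx y hy (α / (α + β)) (β / (α + β)) (by positivity)
    (by positivity) (by field_simp)
  have h1 : (α / (α + β)) • x + (β / (α + β)) • y = (α + β)⁻¹ • (α • x + β • y) := by
    rw [smul_add, smul_smul, smul_smul]
    congr 2 <;> field_simp
  rw [h1] at key
  simp only [Prod.mk_add_mk, inv_smul_smul₀ hα.ne', inv_smul_smul₀ hβ.ne', key]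
  congr 1
  field_simp

theorem isLatticeCone (H : IsPerspective S T g h) (hS : IsLatticeCone (coneOver S)) :
    IsLatticeCone (coneOver T) :=
  IsLatticeCone.of_additive (Φ := fun p => (p.1, p.2 * g (p.2⁻¹ • p.1)))
    (Ψ := fun p => (p.1, p.2 * h (p.2⁻¹ • p.1)))
    (fun _ hp => H.coneOver_mapsTo hp) (fun _ hp => H.symm.coneOver_mapsTo hp)
    (fun _ hp => H.symm.coneOver_left_inv hp)
    (fun _ hp _ hq => H.coneOver_add hp hq) (fun _ hp _ hq => H.symm.coneOver_add hp hq) hS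

theorem isChoquetSimplex [ContinuousSMul ℝ E] (H : IsPerspective S T g h)
    (hS : IsChoquetSimplex S) : IsChoquetSimplex T where
  isCompact := by
    have := isCompact_iff_compactSpace.1 hS.isCompact
    exact isCompact_iff_compactSpace.2 H.homeomorph.compactSpace
  convex := H.convex_right
  metrizable := by
    have := hS.metrizable
    exact H.homeomorph.symm.isEmbedding.metrizableSpace
  lattice := H.isLatticeCone hS.lattice

theorem isBauerSimplex [ContinuousSMul ℝ E] (H : IsPerspective S T g h)
    (hS : IsBauerSimplex S) : IsBauerSimplex T where
  toIsChoquetSimplex := H.isChoquetSimplex hS.toIsChoquetSimplex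
  isCompact_extremePoints := by
    rw [← H.image_extremePoints]
    exact hS.isCompact_extremePoints.image_of_continuousOn
      (H.continuousOn.mono extremePoints_subset)

theorem image_convexHull_subset (H : IsPerspective S T g h) {K : Set E} (hK : K ⊆ S) :
    (fun x => (g x)⁻¹ • x) '' convexHull ℝ K ⊆
      convexHull ℝ ((fun x => (g x)⁻¹ • x) '' K) := by
  have : convexHull ℝ K ⊆
      {x ∈ S | (g x)⁻¹ • x ∈ convexHull ℝ ((fun x => (g x)⁻¹ • x) '' K)} := by
    refine convexHull_min (fun x hx => ⟨hK hx, subset_convexHull _ _ ⟨x, hx, rfl⟩⟩) ?_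
    rw [convex_iff_openSegment_subset]
    rintro x ⟨hx, hx'⟩ y ⟨hy, hy'⟩ z hz
    exact ⟨H.convex_left.openSegment_subset hx hy hz,
      (convex_convexHull ℝ _).openSegment_subset hx' hy' (H.mem_openSegment hx hy hz)⟩
  exact Set.image_subset_iff.2 fun x hx => (this hx).2

theorem image_closure_subset [ContinuousSMul ℝ E] (H : IsPerspective S T g h)
    (hS : IsClosed S) {K : Set E} (hK : K ⊆ S) :
    (fun x => (g x)⁻¹ • x) '' closure (convexHull ℝ K) ⊆
      closure (convexHull ℝ ((fun x => (g x)⁻¹ • x) '' K)) := by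
  have h1 : closure (convexHull ℝ K) ⊆ S :=
    closure_minimal (convexHull_min hK H.convex_left) hS
  exact ((H.continuousOn.mono h1).image_closure).trans
    (closure_mono (H.image_convexHull_subset hK))

/-- Equality follows from the one-sided inclusion for the projection and for its inverse. Closedness
of `S` and `T` keeps the closures inside the domains of continuity. -/
theorem image_closure [ContinuousSMul ℝ E] (H : IsPerspective S T g h)
    (hS : IsClosed S) (hT : IsClosed T) {K : Set E} (hK : K ⊆ S) :
    (fun x => (g x)⁻¹ • x) '' closure (convexHull ℝ K) =
      closure (convexHull ℝ ((fun x => (g x)⁻¹ • x) '' K)) := by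
  refine (H.image_closure_subset hS hK).antisymm ?_
  have h0 : (fun x => (g x)⁻¹ • x) '' K ⊆ T := (Set.image_mono hK).trans H.image_subset
  have h1 := H.symm.image_closure_subset hT h0
  rw [H.image_image hK] at h1
  have h2 := Set.image_mono (f := fun x => (g x)⁻¹ • x) h1
  rwa [H.symm.image_image (closure_minimal (convexHull_min h0 H.convex_right) hT)] at h2

/-- The representing measure is reweighted by `g / g t` and pushed forward. It has mass 1 because `∫
g dμ = g t`, and integrating `f` against it means integrating the affine function `g x * f ((g x)⁻¹
• x)` against `μ`. -/
theorem image_concentratedOn_subset [ContinuousSMul ℝ E] (H : IsPerspective S T g h)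
    (K : Set E) :
    (fun x => (g x)⁻¹ • x) '' concentratedOn S K ⊆
      concentratedOn T ((fun x => (g x)⁻¹ • x) '' K) := by
  rintro _ ⟨t, ⟨ht, μ, ⟨hμ, hint⟩, hnull⟩, rfl⟩
  refine ⟨H.mapsTo_left t ht, ?_⟩
  let _ : MeasurableSpace (S.extremePoints ℝ) := borel _
  have : BorelSpace (S.extremePoints ℝ) := ⟨rfl⟩
  let _ : MeasurableSpace (T.extremePoints ℝ) := borel _
  have : BorelSpace (T.extremePoints ℝ) := ⟨rfl⟩
  have gt := H.pos_left t ht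
  have hg : Continuous fun x : S.extremePoints ℝ => (g t)⁻¹ * g x :=
    continuous_const.mul (continuousOn_iff_continuous_domRestrict.1
      (H.affine_left.1.mono extremePoints_subset))
  have hg0 : ∀ x : S.extremePoints ℝ, 0 ≤ (g t)⁻¹ * g x := fun x => by
    have := H.pos_left x x.2.1
    positivity
  have hme := H.extremeHomeomorph.measurableEmbedding
  refine ⟨(μ.withDensity fun x => ENNReal.ofReal ((g t)⁻¹ * g x)).map H.extremeHomeomorph,
    ⟨⟨?_⟩, fun f hf => ?_⟩, ?_⟩
  · have h1 : ∫ x : S.extremePoints ℝ, (g t)⁻¹ * g x ∂μ = 1 := by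
      rw [integral_const_mul, hint g H.affine_left, inv_mul_cancel₀ gt.ne']
    -- Integrability comes for free: the integral of a non-integrable function is 0 by convention,
    -- and here it is 1.
    rw [hme.map_apply, Set.preimage_univ, withDensity_apply _ MeasurableSet.univ,
      Measure.restrict_univ, ← ofReal_integral_eq_lintegral_ofReal
        (Integrable.of_integral_ne_zero (by rw [h1]; exact one_ne_zero))
        (Filter.Eventually.of_forall hg0), h1, ENNReal.ofReal_one]
  · rw [hme.integral_map, integral_withDensity_eq_integral_toReal_smul
      hg.measurable.ennreal_ofReal (Filter.Eventually.of_forall fun _ => ENNReal.ofReal_lt_top)]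
    have h1 := hint _ (H.isContAffineOn_mul hf)
    calc _ = ∫ x : S.extremePoints ℝ, (g t)⁻¹ * (g x * f ((g x)⁻¹ • (x : E))) ∂μ := by
          refine integral_congr_ae (Filter.Eventually.of_forall fun x => ?_)
          simp only [ENNReal.toReal_ofReal (hg0 x), smul_eq_mul, mul_assoc]
          rfl
      _ = _ := by rw [integral_const_mul, h1, inv_mul_cancel_left₀ gt.ne']
  · rw [hme.map_apply]
    refine withDensity_absolutelyContinuous _ _ (measure_mono_null ?_ hnull)
    intro x hx hxK
    exact hx ⟨x, hxK, rfl⟩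

theorem image_concentratedOn [ContinuousSMul ℝ E] (H : IsPerspective S T g h)
    {K : Set E} (hK : K ⊆ S) :
    (fun x => (g x)⁻¹ • x) '' concentratedOn S K =
      concentratedOn T ((fun x => (g x)⁻¹ • x) '' K) := by
  refine (H.image_concentratedOn_subset K).antisymm ?_
  have h1 := H.symm.image_concentratedOn_subset ((fun x => (g x)⁻¹ • x) '' K)
  rw [H.image_image hK] at h1
  have h2 := Set.image_mono (f := fun x => (g x)⁻¹ • x) h1
  rwa [H.symm.image_image fun x hx => hx.1] at h2

end IsPerspective

theorem CoveringDimLE.of_homeomorph {X Y : Type v} [TopologicalSpace X] [TopologicalSpace Y]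
    (f : X ≃ₜ Y) {n : ℕ} (hX : CoveringDimLE X n) : CoveringDimLE Y n := by
  intro U hfin hopen hcov
  obtain ⟨V, hVf, hVo, hVc, hVr, hVn⟩ := hX ((fun u => f ⁻¹' u) '' U) (hfin.image _)
    (by rintro _ ⟨u, hu, rfl⟩; exact (hopen u hu).preimage f.continuous)
    (by
      rw [Set.sUnion_image, ← Set.preimage_iUnion₂, ← Set.sUnion_eq_biUnion, hcov,
        Set.preimage_univ])
  refine ⟨(fun w => f '' w) '' V, hVf.image _, ?_, ?_, ?_, fun y => ?_⟩
  · rintro _ ⟨w, hw, rfl⟩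
    exact f.isOpenMap _ (hVo w hw)
  · rw [Set.sUnion_image, ← Set.image_iUnion₂, ← Set.sUnion_eq_biUnion, hVc, Set.image_univ,
      f.range_coe]
  · rintro _ ⟨w, hw, rfl⟩
    obtain ⟨_, ⟨u, hu, rfl⟩, hwu⟩ := hVr w hw
    exact ⟨u, hu, Set.image_subset_iff.2 hwu⟩
  · refine le_trans ?_ (hVn (f.symm y))
    have : {w ∈ (fun w => f '' w) '' V | y ∈ w} ⊆
        (fun w => f '' w) '' {w ∈ V | f.symm y ∈ w} := by
      rintro _ ⟨⟨w, hw, rfl⟩, x, hx, rfl⟩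
      exact ⟨w, ⟨hw, by simpa using hx⟩, rfl⟩
    have hf := hVf.subset (Set.sep_subset V fun w => f.symm y ∈ w)
    exact (Set.ncard_le_ncard this (hf.image _)).trans (Set.ncard_image_le hf)

namespace IsPerspective

variable {S T : Set E} {g h : E → ℝ}

theorem conditionC [ContinuousSMul ℝ E] (H : IsPerspective S T g h) (hS : IsClosed S)
    (hT : IsClosed T) (hC : ConditionC S) : ConditionC T := by
  obtain ⟨X, hX, hU, hM⟩ := hC
  have hXS : ∀ n, X n ⊆ S := fun n =>
    ((Set.subset_iUnion X n).trans hU.ge).trans extremePoints_subset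
  refine ⟨fun n => (fun x => (g x)⁻¹ • x) '' X n, fun n => ⟨?_, ?_⟩, ?_, fun k m => ?_⟩
  · exact (hX n).1.image_of_continuousOn (H.continuousOn.mono (hXS n))
  · obtain ⟨d, hd⟩ := (hX n).2
    refine ⟨d, hd.of_homeomorph ?_⟩
    exact
      { toEquiv := Equiv.Set.imageOfInjOn _ _ (H.injOn.mono (hXS n))
        continuous_toFun := (continuousOn_iff_continuous_domRestrict.1
          (H.continuousOn.mono (hXS n))).subtype_mk _
        -- The abstract inverse of the injection agrees with the inverse projection, whose
        -- continuity is known.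
        continuous_invFun := by
          rw [continuous_induced_rng]
          have h1 := continuousOn_iff_continuous_domRestrict.1
            (H.symm.continuousOn.mono ((Set.image_mono (hXS n)).trans H.image_subset))
          refine h1.congr ?_
          rintro ⟨_, x, hx, rfl⟩
          have : (Equiv.Set.imageOfInjOn _ _ (H.injOn.mono (hXS n))).symm
              ⟨(g x)⁻¹ • x, x, hx, rfl⟩ = ⟨x, hx⟩ := by
            rw [Equiv.symm_apply_eq]
            rfl
          exact (H.left_inv (hXS n hx)).trans (congrArg Subtype.val this).symm }
  · rw [← H.image_extremePoints, hU, Set.image_iUnion]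
  · have hKS : ⋃ j ∈ Set.Icc 1 m, X (j + k) ⊆ S := Set.iUnion₂_subset fun j _ => hXS _
    have hDS : S.extremePoints ℝ \ ⋃ j ∈ Set.Icc 1 m, X (j + k) ⊆ S :=
      Set.sdiff_subset.trans extremePoints_subset
    obtain ⟨h1, h2⟩ := hM k m
    rw [← Set.image_iUnion₂, ← H.image_diff hKS, ← H.image_closure hS hT hKS,
      ← H.image_closure hS hT hDS, ← H.image_concentratedOn hKS, ← H.image_concentratedOn hDS,
      h1, h2]
    exact ⟨rfl, rfl⟩

end IsPerspective

end Perspective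

/-! ### Affine extension from the boundary of a Bauer simplex. -/

section Bauer

theorem left_mem_convexJoin_graph {E : Type v} [AddCommGroup E] [Module ℝ E] {S : Set E} {a b : E → ℝ}
    {x : E} (hx : x ∈ S) :
    (x, a x) ∈ convexJoin ℝ ((fun x => (x, a x)) '' S) ((fun x => (x, b x)) '' S) :=
  subset_convexJoin_left (Set.Nonempty.image _ ⟨x, hx⟩) (Set.mem_image_of_mem _ hx)

theorem right_mem_convexJoin_graph {E : Type v} [AddCommGroup E] [Module ℝ E] {S : Set E} {a b : E → ℝ}
    {x : E} (hx : x ∈ S) :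
    (x, b x) ∈ convexJoin ℝ ((fun x => (x, a x)) '' S) ((fun x => (x, b x)) '' S) :=
  subset_convexJoin_right (Set.Nonempty.image _ ⟨x, hx⟩)
    (Set.mem_image_of_mem (fun x => (x, b x)) hx)

/-- With `j = p₁ ⊔ q₁`, the entry `r₁₁` is the meet `p₁ + q₁ - j`. The last entry `p₁ + p₂ - j` lies
in `P` because `p₁ + p₂ = q₁ + q₂` dominates both `p₁` and `q₁`. -/
theorem exists_riesz_decomposition {F : Type v} [AddCommGroup F] {P : Set F}
    (hP : IsLatticeCone P) (hadd : ∀ p ∈ P, ∀ q ∈ P, p + q ∈ P) {p₁ p₂ q₁ q₂ : F}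
    (hp₁ : p₁ ∈ P) (hp₂ : p₂ ∈ P) (hq₁ : q₁ ∈ P) (hq₂ : q₂ ∈ P) (h : p₁ + p₂ = q₁ + q₂) :
    ∃ r₁₁ ∈ P, ∃ r₁₂ ∈ P, ∃ r₂₁ ∈ P, ∃ r₂₂ ∈ P,
      p₁ = r₁₁ + r₁₂ ∧ p₂ = r₂₁ + r₂₂ ∧ q₁ = r₁₁ + r₂₁ ∧ q₂ = r₁₂ + r₂₂ := by
  obtain ⟨j, hj, hj₁, hj₂, hmin⟩ := hP p₁ hp₁ q₁ hq₁
  refine ⟨p₁ + q₁ - j, hmin _ (hadd _ hp₁ _ hq₁) (by simpa) (by simpa), j - q₁, hj₂, j - p₁, hj₁,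
    p₁ + p₂ - j, hmin _ (hadd _ hp₁ _ hp₂) (by simpa) (by simpa [h]), ?_, ?_, ?_, ?_⟩
  · abel
  · abel
  · abel
  · rw [h]; abel

variable {E : Type v} [AddCommGroup E] [Module ℝ E] [TopologicalSpace E]

/-- Affinity in homogeneous form, for use on identities in the cone; `α = 0` is allowed. -/
theorem IsContAffineOn.smul_eq {S : Set E} {f : E → ℝ} (hf : IsContAffineOn S f) {x y z : E}
    (hy : y ∈ S) (hz : z ∈ S) {α β γ : ℝ} (hβ : 0 ≤ β) (hγ : 0 ≤ γ)
    (hα : α = β + γ) (h : α • x = β • y + γ • z) : α * f x = β * f y + γ * f z := by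
  rcases (hα ▸ add_nonneg hβ hγ : 0 ≤ α).eq_or_lt with h0 | h0
  · have h1 : β = 0 := by linarith
    have h2 : γ = 0 := by linarith
    simp [← h0, h1, h2]
  · have h1 : x = (β / α) • y + (γ / α) • z := by
      rw [div_eq_inv_mul, div_eq_inv_mul, mul_smul, mul_smul, ← smul_add, ← h,
        inv_smul_smul₀ h0.ne']
    rw [h1, hf.2 y hy z hz _ _ (by positivity) (by positivity)
      (by rw [← add_div, ← hα, div_self h0.ne'])]
    field_simp

theorem isContAffineOn_clm_add_const (S : Set E) (φ : StrongDual ℝ E) (c : ℝ) :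
    IsContAffineOn S fun x => φ x + c := by
  refine ⟨(φ.continuous.add continuous_const).continuousOn, fun x _ y _ a b _ _ hab => ?_⟩
  simp only [map_add, map_smul, smul_eq_mul]
  linear_combination -c * hab

theorem IsContAffineOn.sub {S : Set E} {f g : E → ℝ} (hf : IsContAffineOn S f)
    (hg : IsContAffineOn S g) : IsContAffineOn S fun x => f x - g x := by
  refine ⟨hf.1.sub hg.1, fun x hx y hy a b ha hb hab => ?_⟩
  simp only [hf.2 x hx y hy a b ha hb hab, hg.2 x hx y hy a b ha hb hab]
  ring

/-- The join of two compact sets is a continuous image of `s × t × [0, 1]`, so separation applies to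
joins of graphs without passing to closures. -/
theorem isCompact_convexJoin [ContinuousAdd E] [ContinuousSMul ℝ E] {s t : Set E}
    (hs : IsCompact s) (ht : IsCompact t) : IsCompact (convexJoin ℝ s t) := by
  have h : convexJoin ℝ s t = (fun p : E × E × ℝ => (1 - p.2.2) • p.1 + p.2.2 • p.2.1) ''
      (s ×ˢ t ×ˢ Set.Icc (0 : ℝ) 1) := by
    ext x
    simp only [mem_convexJoin, segment_eq_image, Set.mem_image]
    constructor
    · rintro ⟨a, ha, b, hb, r, hr, rfl⟩
      exact ⟨(a, b, r), ⟨ha, hb, hr⟩, rfl⟩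
    · rintro ⟨⟨a, b, r⟩, ⟨ha, hb, hr⟩, rfl⟩
      exact ⟨a, ha, b, hb, r, hr, rfl⟩
  rw [h]
  exact (hs.prod (ht.prod isCompact_Icc)).image (by fun_prop)

theorem IsContAffineOn.isCompact_graph {S : Set E} (hS : IsCompact S) {f : E → ℝ}
    (hf : IsContAffineOn S f) : IsCompact ((fun x => (x, f x)) '' S) :=
  hS.image_of_continuousOn (continuousOn_id.prodMk hf.1)

theorem IsContAffineOn.convex_graph {S : Set E} (hS : Convex ℝ S) {f : E → ℝ}
    (hf : IsContAffineOn S f) : Convex ℝ ((fun x => (x, f x)) '' S) := by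
  rintro _ ⟨x, hx, rfl⟩ _ ⟨y, hy, rfl⟩ a b ha hb hab
  exact ⟨a • x + b • y, hS hx hy ha hb hab, by
    simp only [hf.2 x hx y hy a b ha hb hab]; rfl⟩

/-- If the cone over `S` is a lattice and the affine functions `a`, `b` are strictly below `c`, `d`,
then the convex hull of the graphs of `a` and `b` lies strictly below that of `c` and `d`. -/
theorem lt_of_mem_convexJoin {S : Set E} (hconv : Convex ℝ S) (hlat : IsLatticeCone (coneOver S))
    {a b c d : E → ℝ} (ha : IsContAffineOn S a) (hb : IsContAffineOn S b)
    (hc : IsContAffineOn S c) (hd : IsContAffineOn S d)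
    (hac : ∀ x ∈ S, a x < c x) (had : ∀ x ∈ S, a x < d x)
    (hbc : ∀ x ∈ S, b x < c x) (hbd : ∀ x ∈ S, b x < d x) {x : E} {s t : ℝ}
    (hs : (x, s) ∈ convexJoin ℝ ((fun x => (x, a x)) '' S) ((fun x => (x, b x)) '' S))
    (ht : (x, t) ∈ convexJoin ℝ ((fun x => (x, c x)) '' S) ((fun x => (x, d x)) '' S)) :
    s < t := by
  rw [mem_convexJoin] at hs ht
  obtain ⟨_, ⟨y₁, hy₁, rfl⟩, _, ⟨y₂, hy₂, rfl⟩, α, β, hα, hβ, hαβ, hy⟩ := hs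
  obtain ⟨_, ⟨z₁, hz₁, rfl⟩, _, ⟨z₂, hz₂, rfl⟩, γ, δ, hγ, hδ, hγδ, hz⟩ := ht
  simp only [Prod.smul_mk, Prod.mk_add_mk, Prod.mk.injEq, smul_eq_mul] at hy hz
  have hP : ∀ p ∈ coneOver S, ∀ q ∈ coneOver S, p + q ∈ coneOver S :=
    fun p hp q hq => add_mem_coneOver hconv hp hq
  -- The two representations of `(x, 1)` in the cone have a common refinement `ρᵢ wᵢ`. Over it, `s`
  -- is a sum of terms `ρᵢ a(wᵢ)` or `ρᵢ b(wᵢ)`, and `t` is the matching sum with `c` or `d`.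
  obtain ⟨_, ⟨ρ₁, h1, w₁, hw₁, rfl⟩, _, ⟨ρ₂, h2, w₂, hw₂, rfl⟩, _, ⟨ρ₃, h3, w₃, hw₃, rfl⟩,
    _, ⟨ρ₄, h4, w₄, hw₄, rfl⟩, e1, e2, e3, e4⟩ := exists_riesz_decomposition hlat hP
      (p₁ := (α • y₁, α)) (p₂ := (β • y₂, β)) (q₁ := (γ • z₁, γ)) (q₂ := (δ • z₂, δ))
      ⟨α, hα, y₁, hy₁, rfl⟩ ⟨β, hβ, y₂, hy₂, rfl⟩ ⟨γ, hγ, z₁, hz₁, rfl⟩ ⟨δ, hδ, z₂, hz₂, rfl⟩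
      (by simp only [Prod.mk_add_mk, hy.1, hz.1, hαβ, hγδ])
  simp only [Prod.mk_add_mk, Prod.mk.injEq] at e1 e2 e3 e4
  have i1 := ha.smul_eq hw₁ hw₂ h1 h2 e1.2 e1.1
  have i2 := hb.smul_eq hw₃ hw₄ h3 h4 e2.2 e2.1
  have i3 := hc.smul_eq hw₁ hw₃ h1 h3 e3.2 e3.1
  have i4 := hd.smul_eq hw₂ hw₄ h2 h4 e4.2 e4.1
  have j1 := mul_nonneg h1 (sub_pos.2 (hac _ hw₁)).le
  have j2 := mul_nonneg h2 (sub_pos.2 (had _ hw₂)).le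
  have j3 := mul_nonneg h3 (sub_pos.2 (hbc _ hw₃)).le
  have j4 := mul_nonneg h4 (sub_pos.2 (hbd _ hw₄)).le
  -- If `t ≤ s`, all the nonnegative differences vanish, so every `ρᵢ` is 0, although they sum to 1.
  by_contra! hst
  have k1 : ρ₁ * (c w₁ - a w₁) = 0 := by linarith
  have k2 : ρ₂ * (d w₂ - a w₂) = 0 := by linarith
  have k3 : ρ₃ * (c w₃ - b w₃) = 0 := by linarith
  have k4 : ρ₄ * (d w₄ - b w₄) = 0 := by linarith
  rw [mul_eq_zero_iff_right (sub_pos.2 (hac _ hw₁)).ne'] at k1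
  rw [mul_eq_zero_iff_right (sub_pos.2 (had _ hw₂)).ne'] at k2
  rw [mul_eq_zero_iff_right (sub_pos.2 (hbc _ hw₃)).ne'] at k3
  rw [mul_eq_zero_iff_right (sub_pos.2 (hbd _ hw₄)).ne'] at k4
  linarith [e1.2, e2.2]

variable [IsTopologicalAddGroup E] [ContinuousSMul ℝ E] [LocallyConvexSpace ℝ E] [T2Space E]

/-- Separation of a compact convex set of `E × ℝ` from one that lies above it by the graph of a
continuous affine function. -/
theorem exists_affine_between {Y Z : Set (E × ℝ)} (hYc : Convex ℝ Y) (hYk : IsCompact Y)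
    (hZc : Convex ℝ Z) (hZk : IsCompact Z) (hdisj : Disjoint Y Z) {x₀ : E} {s₀ t₀ : ℝ}
    (hs₀ : (x₀, s₀) ∈ Y) (ht₀ : (x₀, t₀) ∈ Z) (hst : s₀ < t₀) :
    ∃ (φ : StrongDual ℝ E) (r : ℝ),
      (∀ x s, (x, s) ∈ Y → s < φ x + r) ∧ ∀ x t, (x, t) ∈ Z → φ x + r < t := by
  obtain ⟨f, u, w, hu, huw, hw⟩ :=
    geometric_hahn_banach_compact_closed hYc hYk hZc hZk.isClosed hdisj
  set ψ : StrongDual ℝ E := f.comp (ContinuousLinearMap.inl ℝ E ℝ) with hψ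
  set l : ℝ := f (0, 1) with hl
  have hf : ∀ x s, f (x, s) = ψ x + s * l := by
    intro x s
    have : ((x, s) : E × ℝ) = (x, 0) + s • (0, 1) := by simp
    rw [this, map_add, map_smul]
    rfl
  -- The two points over `x₀` show that the separating hyperplane is not vertical, so `f = u` is the
  -- graph of an affine function.
  have hl0 : 0 < l := by
    have h1 := hu _ hs₀
    have h2 := hw _ ht₀
    rw [hf] at h1 h2
    by_contra! h
    nlinarith
  refine ⟨-(l⁻¹ • ψ), u / l, fun x s hs => ?_, fun x t ht => ?_⟩
  · have h1 := hu _ hs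
    rw [hf] at h1
    have h2 : (-(l⁻¹ • ψ)) x + u / l = (u - ψ x) / l := by
      simp only [neg_apply, smul_apply, smul_eq_mul]
      field_simp
      ring
    rw [h2, lt_div_iff₀ hl0]
    linarith
  · have h1 := hw _ ht
    rw [hf] at h1
    have h2 : (-(l⁻¹ • ψ)) x + u / l = (u - ψ x) / l := by
      simp only [neg_apply, smul_apply, smul_eq_mul]
      field_simp
      ring
    rw [h2, div_lt_iff₀ hl0]
    linarith

/-- The interpolation property of continuous affine functions on a simplex. -/
theorem IsChoquetSimplex.exists_interpolation {S : Set E} (hS : IsChoquetSimplex S)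
    (hne : S.Nonempty) {a b c d : E → ℝ} (ha : IsContAffineOn S a) (hb : IsContAffineOn S b)
    (hc : IsContAffineOn S c) (hd : IsContAffineOn S d)
    (hac : ∀ x ∈ S, a x < c x) (had : ∀ x ∈ S, a x < d x)
    (hbc : ∀ x ∈ S, b x < c x) (hbd : ∀ x ∈ S, b x < d x) :
    ∃ (φ : StrongDual ℝ E) (r : ℝ), ∀ x ∈ S,
      a x < φ x + r ∧ b x < φ x + r ∧ φ x + r < c x ∧ φ x + r < d x := by
  obtain ⟨x₀, hx₀⟩ := hne
  obtain ⟨φ, r, h1, h2⟩ := exists_affine_between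
    ((ha.convex_graph hS.convex).convexJoin (hb.convex_graph hS.convex))
    (isCompact_convexJoin (ha.isCompact_graph hS.isCompact) (hb.isCompact_graph hS.isCompact))
    ((hc.convex_graph hS.convex).convexJoin (hd.convex_graph hS.convex))
    (isCompact_convexJoin (hc.isCompact_graph hS.isCompact) (hd.isCompact_graph hS.isCompact))
    (Set.disjoint_left.2 fun p hp hq => lt_irrefl p.2
      (lt_of_mem_convexJoin hS.convex hS.lattice ha hb hc hd hac had hbc hbd (x := p.1) hp hq))
    (left_mem_convexJoin_graph hx₀) (left_mem_convexJoin_graph hx₀) (hac _ hx₀)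
  exact ⟨φ, r, fun x hx => ⟨h1 _ _ (left_mem_convexJoin_graph hx),
    h1 _ _ (right_mem_convexJoin_graph hx), h2 _ _ (left_mem_convexJoin_graph hx),
    h2 _ _ (right_mem_convexJoin_graph hx)⟩⟩

/-- At an extreme point the upper envelope of `max a b` is `max a b`. -/
theorem exists_affine_gt_of_mem_extremePoints {S : Set E} (hS : IsChoquetSimplex S)
    {a b : E → ℝ} (ha : IsContAffineOn S a) (hb : IsContAffineOn S b) {k : E}
    (hk : k ∈ S.extremePoints ℝ) {ε : ℝ} (hε : 0 < ε) :
    ∃ (φ : StrongDual ℝ E) (r : ℝ), (∀ x ∈ S, a x < φ x + r ∧ b x < φ x + r) ∧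
      φ k + r < max (a k) (b k) + ε := by
  -- The join of the two graphs is separated from one point above `k`. Extremality of `k` means that
  -- the join over `k` uses only values at `k`, hence stays below `max (a k) (b k)`.
  obtain ⟨φ, r, h1, h2⟩ := exists_affine_between (x₀ := k) (s₀ := a k)
    (t₀ := max (a k) (b k) + ε) (Z := {(k, max (a k) (b k) + ε)})
    ((ha.convex_graph hS.convex).convexJoin (hb.convex_graph hS.convex))
    (isCompact_convexJoin (ha.isCompact_graph hS.isCompact) (hb.isCompact_graph hS.isCompact))
    (convex_singleton _) isCompact_singleton (by
      rw [Set.disjoint_singleton_right, mem_convexJoin]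
      rintro ⟨_, ⟨y, hy, rfl⟩, _, ⟨z, hz, rfl⟩, α, β, hα, hβ, hαβ, h⟩
      simp only [Prod.smul_mk, Prod.mk_add_mk, Prod.mk.injEq, smul_eq_mul] at h
      have hm1 := le_max_left (a k) (b k)
      have hm2 := le_max_right (a k) (b k)
      rcases hα.eq_or_lt with rfl | hα
      · obtain rfl : β = 1 := by linarith
        have : z = k := by simpa using h.1
        subst this
        linarith [h.2]
      rcases hβ.eq_or_lt with rfl | hβ
      · obtain rfl : α = 1 := by linarith
        have : y = k := by simpa using h.1
        subst this
        linarith [h.2]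
      have hy' : y = k := hk.2 hy hz ⟨α, β, hα, hβ, hαβ, h.1⟩
      have hz' : z = k := hk.2 hz hy ⟨β, α, hβ, hα, by linarith, by rw [add_comm]; exact h.1⟩
      subst hy'
      subst hz'
      have h1 := mul_le_mul_of_nonneg_left hm1 hα.le
      have h2 := mul_le_mul_of_nonneg_left hm2 hβ.le
      have h3 : α * max (a z) (b z) + β * max (a z) (b z) = max (a z) (b z) := by
        rw [← add_mul, hαβ, one_mul]
      linarith [h.2]) (left_mem_convexJoin_graph hk.1) rfl
    (by linarith [le_max_left (a k) (b k)])
  exact ⟨φ, r, fun x hx => ⟨h1 _ _ (left_mem_convexJoin_graph hx),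
    h1 _ _ (right_mem_convexJoin_graph hx)⟩, h2 _ _ rfl⟩

/-- A closed convex condition that holds at the extreme points of a compact convex set holds
everywhere on the set. -/
theorem forall_mem_of_extremePoints {S : Set E} (hk : IsCompact S) (hc : Convex ℝ S)
    {p : E → Prop} (hcl : IsClosed {x ∈ S | p x}) (hconv : Convex ℝ {x ∈ S | p x})
    (h : ∀ x ∈ S.extremePoints ℝ, p x) : ∀ x ∈ S, p x := by
  have h3 : S ⊆ {x ∈ S | p x} := by
    conv_lhs => rw [← closure_convexHull_extremePoints hk hc]
    exact closure_minimal (convexHull_min (fun x hx => ⟨hx.1, h x hx⟩) hconv) hcl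
  exact fun x hx => (h3 hx).2

theorem IsContAffineOn.le_of_extremePoints {S : Set E} (hk : IsCompact S) (hc : Convex ℝ S)
    {f : E → ℝ} (hf : IsContAffineOn S f) {r : ℝ} (h : ∀ x ∈ S.extremePoints ℝ, f x ≤ r) :
    ∀ x ∈ S, f x ≤ r := by
  refine forall_mem_of_extremePoints hk hc
    (hf.1.preimage_isClosed_of_isClosed hk.isClosed isClosed_Iic) ?_ h
  rintro x ⟨hx, hx'⟩ y ⟨hy, hy'⟩ a b ha hb hab
  refine ⟨hc hx hy ha hb hab, ?_⟩
  rw [hf.2 x hx y hy a b ha hb hab]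
  calc a * f x + b * f y ≤ a * r + b * r := by gcongr
    _ = r := by rw [← add_mul, hab, one_mul]

/-- On the extremal boundary of a Bauer simplex the maximum of two affine functions is a uniform
limit of affine functions. -/
theorem IsBauerSimplex.exists_affine_near_max {S : Set E} (hS : IsBauerSimplex S)
    (hne : S.Nonempty) {a b : E → ℝ} (ha : IsContAffineOn S a) (hb : IsContAffineOn S b) {ε : ℝ}
    (hε : 0 < ε) :
    ∃ (φ : StrongDual ℝ E) (r : ℝ), ∀ k ∈ S.extremePoints ℝ,
      max (a k) (b k) < φ k + r ∧ φ k + r < max (a k) (b k) + ε := by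
  suffices H : ∃ (φ : StrongDual ℝ E) (r : ℝ), (∀ x ∈ S, a x < φ x + r ∧ b x < φ x + r) ∧
      ∀ k ∈ S.extremePoints ℝ, φ k + r < max (a k) (b k) + ε by
    obtain ⟨φ, r, h1, h2⟩ := H
    exact ⟨φ, r, fun k hk => ⟨max_lt (h1 k hk.1).1 (h1 k hk.1).2, h2 k hk⟩⟩
  have hext : S.extremePoints ℝ ⊆ S := extremePoints_subset
  -- Compactness induction over sets on which some global affine majorant of `a` and `b` is close to
  -- the maximum. For a union, interpolation inserts an affine function below both majorants.
  refine hS.isCompact_extremePoints.induction_on (p := fun s => ∃ (φ : StrongDual ℝ E) (r : ℝ),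
    (∀ x ∈ S, a x < φ x + r ∧ b x < φ x + r) ∧
      ∀ k ∈ s ∩ S.extremePoints ℝ, φ k + r < max (a k) (b k) + ε) ?_ ?_ ?_ ?_ |>.imp
      fun φ h => h.imp fun r h => ⟨h.1, fun k hk => h.2 k ⟨hk, hk⟩⟩
  · obtain ⟨k, hk⟩ := hS.isCompact.extremePoints_nonempty hne
    obtain ⟨φ, r, h, -⟩ :=
      exists_affine_gt_of_mem_extremePoints hS.toIsChoquetSimplex ha hb hk hε
    exact ⟨φ, r, h, by simp⟩
  · rintro s t hst ⟨φ, r, h1, h2⟩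
    exact ⟨φ, r, h1, fun k hk => h2 k ⟨hst hk.1, hk.2⟩⟩
  · rintro s t ⟨φ, r, h1, h2⟩ ⟨φ', r', h1', h2'⟩
    obtain ⟨ψ, q, h⟩ := hS.exists_interpolation hne ha hb
      (isContAffineOn_clm_add_const S φ r) (isContAffineOn_clm_add_const S φ' r')
      (fun x hx => (h1 x hx).1) (fun x hx => (h1' x hx).1)
      (fun x hx => (h1 x hx).2) (fun x hx => (h1' x hx).2)
    refine ⟨ψ, q, fun x hx => ⟨(h x hx).1, (h x hx).2.1⟩, ?_⟩
    rintro k ⟨hk | hk, hke⟩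
    · exact (h k hke.1).2.2.1.trans (h2 k ⟨hk, hke⟩)
    · exact (h k hke.1).2.2.2.trans (h2' k ⟨hk, hke⟩)
  · intro k hk
    obtain ⟨φ, r, h, hlt⟩ :=
      exists_affine_gt_of_mem_extremePoints hS.toIsChoquetSimplex ha hb hk hε
    refine ⟨{x | x ∈ S.extremePoints ℝ → φ x + r < max (a x) (b x) + ε}, ?_, φ, r, h,
      fun x hx => hx.1 hx.2⟩
    have h1 : ContinuousWithinAt (fun x => φ x + r) (S.extremePoints ℝ) k :=
      (φ.continuous.add continuous_const).continuousWithinAt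
    have h2 : ContinuousWithinAt (fun x => max (a x) (b x) + ε) (S.extremePoints ℝ) k :=
      (((ha.1.mono hext).sup (hb.1.mono hext)).add continuousOn_const) k hk
    filter_upwards [h1.eventually_lt h2 hlt] with x hx
    exact fun _ => hx

/-- The restrictions of affine functions are dense in the continuous functions on the extremal
boundary of a Bauer simplex. -/
theorem IsBauerSimplex.exists_affine_near {S : Set E} (hS : IsBauerSimplex S)
    (hne : S.Nonempty) (f : C(S.extremePoints ℝ, ℝ)) {ε : ℝ} (hε : 0 < ε) :
    ∃ (φ : StrongDual ℝ E) (r : ℝ), ∀ k : S.extremePoints ℝ, |φ k + r - f k| < ε := by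
  have := isCompact_iff_compactSpace.1 hS.isCompact_extremePoints
  -- `L` consists of uniform limits of affine restrictions, because maxima are affine only up to
  -- `ε`. It is a lattice separating points strongly, so Stone-Weierstrass applies.
  let L : Set C(S.extremePoints ℝ, ℝ) :=
    {f | ∀ ε > 0, ∃ (φ : StrongDual ℝ E) (r : ℝ), ∀ k : S.extremePoints ℝ, |φ k + r - f k| < ε}
  have hneg : ∀ f ∈ L, -f ∈ L := by
    intro f hf ε hε
    obtain ⟨φ, r, h⟩ := hf ε hε
    refine ⟨-φ, -r, fun k => ?_⟩
    have := h k
    rw [← abs_neg] at this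
    convert! this using 2
    simp only [neg_apply, ContinuousMap.neg_apply]
    ring
  have hsup : ∀ f ∈ L, ∀ g ∈ L, f ⊔ g ∈ L := by
    intro f hf g hg ε hε
    obtain ⟨φ, r, h⟩ := hf (ε / 2) (by positivity)
    obtain ⟨ψ, q, h'⟩ := hg (ε / 2) (by positivity)
    obtain ⟨χ, p, hm⟩ := hS.exists_affine_near_max hne (isContAffineOn_clm_add_const S φ r)
      (isContAffineOn_clm_add_const S ψ q) (half_pos hε)
    refine ⟨χ, p, fun k => ?_⟩
    have h1 := hm k k.2
    have h2 := (abs_max_sub_max_le_max (φ k + r) (ψ k + q) (f k) (g k)).trans_lt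
      (max_lt (h k) (h' k))
    rw [abs_lt] at h2 ⊢
    simp only [ContinuousMap.sup_apply]
    constructor <;> linarith
  have hinf : ∀ f ∈ L, ∀ g ∈ L, f ⊓ g ∈ L := by
    intro f hf g hg
    have := hneg _ (hsup _ (hneg f hf) _ (hneg g hg))
    convert! this using 1
    ext k
    simp [neg_sup]
  have hsep : L.SeparatesPointsStrongly := by
    intro w x y
    by_cases hxy : (x : E) = y
    · refine ⟨.const _ (w x), fun ε hε => ⟨0, w x, fun k => by simpa using hε⟩, rfl, ?_⟩
      rw [← Subtype.ext hxy]
      rfl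
    · obtain ⟨φ, hφ⟩ := geometric_hahn_banach_point_point hxy
      have hne : φ y - φ x ≠ 0 := (sub_pos.2 hφ).ne'
      set m : ℝ := (w y - w x) / (φ y - φ x) with hm
      refine ⟨⟨fun k => (m • φ) k + (w x - m * φ x), by fun_prop⟩,
        fun ε hε => ⟨m • φ, w x - m * φ x, fun k => by simpa using hε⟩, ?_, ?_⟩
      · simp
      · simp only [ContinuousMap.coe_mk, smul_apply, smul_eq_mul, hm]
        field_simp
        ring
  have htop := ContinuousMap.sublattice_closure_eq_top L
    ⟨0, fun ε hε => ⟨0, 0, fun k => by simpa using hε⟩⟩ hinf hsup hsep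
  have hf : f ∈ closure L := by rw [htop]; trivial
  obtain ⟨g, hg, hfg⟩ := Metric.mem_closure_iff.1 hf (ε / 2) (by positivity)
  obtain ⟨φ, r, h⟩ := hg (ε / 2) (by positivity)
  refine ⟨φ, r, fun k => ?_⟩
  have h1 := (ContinuousMap.dist_apply_le_dist (f := f) (g := g) k).trans_lt hfg
  rw [Real.dist_eq] at h1
  have h2 := h k
  rw [abs_lt] at h1 h2 ⊢
  constructor <;> linarith

/-- A continuous function on the extremal boundary of a Bauer simplex extends to a continuous
affine function on the simplex. -/
theorem IsBauerSimplex.exists_affine_extension {S : Set E} (hS : IsBauerSimplex S)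
    (hne : S.Nonempty) (f : C(S.extremePoints ℝ, ℝ)) :
    ∃ F : E → ℝ, IsContAffineOn S F ∧ ∀ k : S.extremePoints ℝ, F k = f k := by
  have hpos : ∀ n : ℕ, (0 : ℝ) < 1 / ((n : ℝ) + 1) := fun n => Nat.one_div_pos_of_nat
  choose φ r h using fun n : ℕ => hS.exists_affine_near hne f (hpos n)
  have haff := fun n => isContAffineOn_clm_add_const S (φ n) (r n)
  -- Differences of approximants are affine, so their bound at extreme points holds on all of `S` by
  -- Krein-Milman.
  have hle : ∀ m n, ∀ x ∈ S, φ m x + r m - (φ n x + r n) ≤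
      1 / ((m : ℝ) + 1) + 1 / ((n : ℝ) + 1) := by
    intro m n
    refine ((haff m).sub (haff n)).le_of_extremePoints hS.isCompact hS.convex fun x hx => ?_
    have h1 := abs_lt.1 (h m ⟨x, hx⟩)
    have h2 := abs_lt.1 (h n ⟨x, hx⟩)
    linarith [h1.2, h2.1]
  have hC : UniformCauchySeqOn (fun n x => φ n x + r n) Filter.atTop S := by
    rw [Metric.uniformCauchySeqOn_iff]
    intro ε hε
    obtain ⟨N, hN⟩ := exists_nat_one_div_lt (half_pos hε)
    refine ⟨N, fun m hm n hn x hx => ?_⟩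
    have h1 := hle m n x hx
    have h2 := hle n m x hx
    have h3 := Nat.one_div_le_one_div (α := ℝ) hm
    have h4 := Nat.one_div_le_one_div (α := ℝ) hn
    rw [Real.dist_eq, abs_lt]
    constructor <;> linarith
  have hlim : ∀ x ∈ S, ∃ l, Filter.Tendsto (fun n => φ n x + r n) Filter.atTop (nhds l) :=
    fun x hx => cauchySeq_tendsto_of_complete (hC.cauchySeq hx)
  choose! F hF using hlim
  have hU := hC.tendstoUniformlyOn_of_tendsto hF
  refine ⟨F, ⟨hU.continuousOn (Filter.Frequently.of_forall fun n => (haff n).1),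
    fun x hx y hy a b ha hb hab => ?_⟩, fun k => ?_⟩
  · refine tendsto_nhds_unique (hF _ (hS.convex hx hy ha hb hab)) ?_
    have := ((hF x hx).const_mul a).add ((hF y hy).const_mul b)
    refine this.congr fun n => ?_
    exact ((haff n).2 x hx y hy a b ha hb hab).symm
  · refine tendsto_nhds_unique (hF k k.2.1) ?_
    rw [tendsto_iff_norm_sub_tendsto_zero]
    exact squeeze_zero (fun n => norm_nonneg _) (fun n => (h n k).le)
      tendsto_one_div_add_atTop_nhds_zero_nat

end Bauer

/-! ### Faithfulness of traces on a simple algebra. -/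

section Traces

variable {B : Type u} [NonUnitalCStarAlgebra B]

theorem IsIdeal.topologicalClosure {I : Submodule ℂ B} (hI : IsIdeal I) :
    IsIdeal I.topologicalClosure := by
  intro x y hy
  constructor
  · exact map_mem_closure (f := fun z => x * z) (continuous_const_mul x) hy fun z hz => (hI x z hz).1
  · exact map_mem_closure (f := fun z => z * x) (continuous_mul_const x) hy fun z hz => (hI x z hz).2

/-- By simplicity the closure of a nonzero ideal is everything, so the ideal is dense and contains
the smallest dense one. -/
theorem ped_le_of_isIdeal (hB : IsSimple B) {I : Submodule ℂ B} (hI : IsIdeal I) (hne : I ≠ ⊥) :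
    ped B ≤ I := by
  refine sInf_le ⟨hI, ?_⟩
  rcases hB _ hI.topologicalClosure I.isClosed_topologicalClosure with h | h
  · exact absurd (le_bot_iff.1 (h ▸ I.le_topologicalClosure)) hne
  · exact Submodule.dense_iff_topologicalClosure_eq_top.2 h

theorem isIdeal_span_mul_mul (w : B) :
    IsIdeal (Submodule.span ℂ {z | ∃ x y : B, z = x * w * y}) := by
  intro a z hz
  induction hz using Submodule.span_induction with
  | mem z h =>
    obtain ⟨x, y, rfl⟩ := h
    exact ⟨Submodule.subset_span ⟨a * x, y, by simp only [mul_assoc]⟩,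
      Submodule.subset_span ⟨x, y * a, by simp only [mul_assoc]⟩⟩
  | zero => simp
  | add x y _ _ hx hy =>
    rw [mul_add, add_mul]
    exact ⟨add_mem hx.1 hy.1, add_mem hx.2 hy.2⟩
  | smul c x _ hx =>
    rw [mul_smul_comm, smul_mul_assoc]
    exact ⟨Submodule.smul_mem _ _ hx.1, Submodule.smul_mem _ _ hx.2⟩

theorem trace_mono [PartialOrder B] [StarOrderedRing B] {τ : ped B → ℂ} (hτ : τ ∈ traces B)
    {x y : ped B} (h : (x : B) ≤ y) : τ x ≤ τ y := by
  have h1 := hτ.2.1 (y - x) (CStarAlgebra.nonneg_iff_eq_star_mul_self.1 (sub_nonneg.2 h))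
  rwa [hτ.1.map_sub, sub_nonneg] at h1

/-- A trace on the Pedersen ideal of a simple C⋆-algebra is zero as soon as it vanishes at some
positive element other than zero. -/
theorem trace_eq_zero (hB : IsSimple B) {τ : ped B → ℂ} (hτ : τ ∈ traces B) {e : ped B}
    (he0 : e ≠ 0) (he : IsPos (e : B)) (h : τ e = 0) : τ = 0 := by
  let _ := CStarAlgebra.spectralOrder B
  have := CStarAlgebra.spectralOrderedRing B
  have hnn : 0 ≤ (e : B) := CStarAlgebra.nonneg_iff_eq_star_mul_self.2 he
  have hsa : star (e : B) = e := hnn.isSelfAdjoint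
  -- With `e = y⋆y`, one has `0 ≤ eze ≤ ‖z‖ e² ≤ ‖z‖ ‖yy⋆‖ e`, and the trace vanishes at `e`.
  have hpos : ∀ z : B, 0 ≤ z → ∀ hz : e * z * e ∈ ped B, τ ⟨e * z * e, hz⟩ = 0 := by
    intro z hz hm
    refine le_antisymm ?_ (hτ.2.1 _ ?_)
    · obtain ⟨y, hy⟩ := he
      have h1 : (e : B) * z * e ≤ ‖z‖ • (e * e : B) := by
        have := CStarAlgebra.star_left_conjugate_le_norm_smul (a := (e : B)) (b := z)
          hz.isSelfAdjoint
        rwa [hsa] at this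
      have h2 : (e * e : B) ≤ ‖y * star y‖ • (e : B) := by
        have := CStarAlgebra.star_left_conjugate_le_norm_smul (a := y) (b := y * star y)
          (.mul_star_self y)
        rw [← hy] at this
        convert! this using 1
        rw [hy]
        simp only [mul_assoc]
      have h3 : (e : B) * z * e ≤ ((‖z‖ * ‖y * star y‖ : ℝ) : ℂ) • (e : B) := by
        rw [Complex.coe_smul, mul_smul]
        exact h1.trans (smul_le_smul_of_nonneg_left h2 (norm_nonneg z))
      have h4 := trace_mono hτ (x := ⟨e * z * e, hm⟩)
        (y := ((‖z‖ * ‖y * star y‖ : ℝ) : ℂ) • e) h3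
      rwa [hτ.1.map_smul, h, smul_zero] at h4
    · refine CStarAlgebra.nonneg_iff_eq_star_mul_self.1 ?_
      have := star_left_conjugate_nonneg hz (e : B)
      rwa [hsa] at this
  have hmid : ∀ z : B, τ ⟨e * z * e, (ped_isIdeal (e * z : B) _ e.2).1⟩ = 0 := by
    intro z
    have hz : z ∈ Submodule.span ℂ {a : B | 0 ≤ a} := by
      rw [CStarAlgebra.span_nonneg]; trivial
    induction hz using Submodule.span_induction with
    | mem z hz => exact hpos z hz _
    | zero =>
      convert hτ.1.map_zero
      simp
    | add x y _ _ hx hy =>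
      rw [← add_zero (0 : ℂ)]
      nth_rw 1 [← hx]
      rw [← hy, ← hτ.1.map_add]
      congr 1
      ext
      simp [mul_add, add_mul]
    | smul c x _ hx =>
      rw [← smul_zero c, ← hx, ← hτ.1.map_smul]
      congr 1
      ext
      simp [mul_smul_comm, smul_mul_assoc]
  have hee : (e * e : B) ≠ 0 := by
    intro h0
    have h1 : star (e : B) * e = 0 := by rwa [hsa]
    exact he0 (Subtype.ext (CStarRing.star_mul_self_eq_zero_iff _ |>.1 h1))
  have heeee : (e * (e * e) * e : B) ≠ 0 := by
    intro h0
    have h1 : star (e * e : B) * (e * e) = 0 := by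
      rw [star_mul, hsa, ← h0]
      simp only [mul_assoc]
    exact hee (CStarRing.star_mul_self_eq_zero_iff _ |>.1 h1)
  -- The ideal is built from `e²` so that `x e² y = (xe)(ey)` has both factors in the Pedersen
  -- ideal; the trace property then gives `τ(x e² y) = τ(e(yx)e) = 0`.
  have hle := ped_le_of_isIdeal hB (isIdeal_span_mul_mul (e * e : B)) (by
    intro hbot
    refine heeee ((Submodule.mem_bot ℂ).1 ?_)
    rw [← hbot]
    exact Submodule.subset_span ⟨e, e, rfl⟩)
  have hmem : Submodule.span ℂ {z | ∃ x y : B, z = x * (e * e) * y} ≤ ped B := by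
    rw [Submodule.span_le]
    rintro _ ⟨x, y, rfl⟩
    exact (ped_isIdeal y _ (ped_isIdeal x _ (ped_isIdeal (e : B) _ e.2).1).1).2
  have hspan : ∀ z (hz : z ∈ Submodule.span ℂ {z | ∃ x y : B, z = x * (e * e) * y}),
      τ ⟨z, hmem hz⟩ = 0 := by
    intro z hz
    induction hz using Submodule.span_induction with
    | mem z hz =>
      obtain ⟨x, y, rfl⟩ := hz
      have h1 := hτ.2.2 ⟨x * e, (ped_isIdeal x _ e.2).1⟩ ⟨e * y, (ped_isIdeal y _ e.2).2⟩
      have h2 := hmid (y * x)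
      rw [← h2]
      refine Eq.trans (congrArg τ (Subtype.ext ?_)) (h1.trans (congrArg τ (Subtype.ext ?_)))
      · change x * (e * e) * y = x * e * (e * y)
        simp only [mul_assoc]
      · change e * y * (x * e) = e * (y * x) * e
        simp only [mul_assoc]
    | zero => exact hτ.1.map_zero
    | add x y hx' hy' hx hy =>
      rw [← add_zero (0 : ℂ)]
      nth_rw 1 [← hx]
      rw [← hy, ← hτ.1.map_add]
      rfl
    | smul c x hx' hx =>
      rw [← smul_zero c, ← hx, ← hτ.1.map_smul]
      rfl
  funext a
  exact hspan a (hle a.2)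

theorem trace_apply_eq_re {τ : ped B → ℂ} (hτ : τ ∈ traces B) {e : ped B}
    (he : IsPos (e : B)) : τ e = ((τ e).re : ℂ) :=
  Complex.ext rfl (by simpa using (Complex.nonneg_iff.1 (hτ.2.1 e he)).2.symm)

theorem trace_re_pos (hB : IsSimple B) {τ : ped B → ℂ} (hτ : τ ∈ traces B \ {0}) {e : ped B}
    (he0 : e ≠ 0) (he : IsPos (e : B)) : 0 < (τ e).re := by
  refine lt_of_le_of_ne (Complex.nonneg_iff.1 (hτ.1.2.1 e he)).1 fun h => hτ.2 ?_
  refine trace_eq_zero hB hτ.1 he0 he ?_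
  rw [trace_apply_eq_re hτ.1 he, ← h, Complex.ofReal_zero]

theorem smul_mem_traces {τ : ped B → ℂ} (hτ : τ ∈ traces B) {r : ℝ} (hr : 0 ≤ r) :
    r • τ ∈ traces B := by
  refine ⟨⟨fun x y => ?_, fun c x => ?_⟩, fun x hx => ?_, fun x y => ?_⟩
  · simp only [Pi.smul_apply, hτ.1.map_add, smul_add]
  · simp only [Pi.smul_apply, hτ.1.map_smul, smul_comm r c]
  · exact smul_nonneg hr (hτ.2.1 x hx)
  · simp only [Pi.smul_apply, hτ.2.2 x y]

theorem add_mem_traces {τ σ : ped B → ℂ} (hτ : τ ∈ traces B) (hσ : σ ∈ traces B) :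
    τ + σ ∈ traces B := by
  refine ⟨⟨fun x y => ?_, fun c x => ?_⟩, fun x hx => ?_, fun x y => ?_⟩
  · simp only [Pi.add_apply, hτ.1.map_add, hσ.1.map_add]
    abel
  · simp only [Pi.add_apply, hτ.1.map_smul, hσ.1.map_smul, smul_add]
  · exact add_nonneg (hτ.2.1 x hx) (hσ.2.1 x hx)
  · simp only [Pi.add_apply, hτ.2.2 x y, hσ.2.2 x y]

end Traces

/-! ### Simplicity from matrix units. -/

section MatrixUnits

/-- A C⋆-algebra `B` that is generated, as a Banach space, by matrix units with coefficients in a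
simple C⋆-algebra is simple. -/
theorem IsSimple.of_matrixUnits {A : Type u} [NonUnitalCStarAlgebra A] {B : Type v}
    [NonUnitalCStarAlgebra B] (hA : IsSimple A) (w : ℕ → ℕ → A →ₗ[ℂ] B)
    (hmul : ∀ a b i j k l, w i j a * w k l b = if j = k then w i l (a * b) else 0)
    (hiso : ∀ i j, Isometry (w i j))
    (hdense : Dense (Submodule.span ℂ {x | ∃ a i j, x = w i j a} : Set B)) : IsSimple B := by
  intro I hI hcl
  rw [or_iff_not_imp_left]
  intro hne
  obtain ⟨T, hTI, hT0⟩ := Submodule.exists_mem_ne_zero_of_ne_bot hne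
  have hind : ∀ V : Submodule ℂ B, IsClosed (V : Set B) → (∀ a i j, w i j a ∈ V) →
      ∀ x, x ∈ V := by
    intro V hV h x
    have h1 : closure (Submodule.span ℂ {x | ∃ a i j, x = w i j a} : Set B) ⊆ V := by
      refine closure_minimal (Submodule.span_le.2 ?_) hV
      rintro _ ⟨a, i, j, rfl⟩
      exact h a i j
    exact h1 (hdense x)
  have hclosed : ∀ (p q : B) (W : Submodule ℂ B), IsClosed (W : Set B) →
      IsClosed ((W.comap ((LinearMap.mulRight ℂ q).comp (LinearMap.mulLeft ℂ p)) :
        Submodule ℂ B) : Set B) := by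
    intro p q W hW
    exact hW.preimage (f := fun x => p * x * q) (by fun_prop)
  -- If all corners of `T` vanished, density would give `R T S = 0` for all `R`, `S`; then `(T⋆T)² =
  -- 0` and `T = 0`.
  obtain ⟨a, b, i, j, k, l, hne0⟩ : ∃ a b i j k l, w k i a * T * w j l b ≠ 0 := by
    by_contra! h0
    have h1 : ∀ a k i S, w k i a * T * S = 0 := by
      intro a k i S
      have := hind (LinearMap.ker (LinearMap.mulLeft ℂ (w k i a * T)))
        (isClosed_singleton.preimage (f := fun x => w k i a * T * x) (by fun_prop))
        (fun b j l => h0 a b i j k l) S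
      exact this
    have h2 : ∀ S R, R * T * S = 0 := by
      intro S R
      have := hind (LinearMap.ker (LinearMap.mulRight ℂ (T * S)))
        (isClosed_singleton.preimage (f := fun x => x * (T * S)) (by fun_prop))
        (fun a k i => by
          have := h1 a k i S
          rw [mul_assoc] at this
          exact this) R
      rw [mul_assoc]
      exact this
    have h3 := h2 (star T * T) (star T)
    have h4 : star (star T * T) * (star T * T) = 0 := by rwa [star_mul, star_star]
    exact hT0 (CStarRing.star_mul_self_eq_zero_iff _ |>.1
      (CStarRing.star_mul_self_eq_zero_iff _ |>.1 h4))
  -- The range is closed, being isometric to the complete space `A`, so it suffices to check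
  -- generators in place of `T`.
  obtain ⟨c, hc⟩ : w k i a * T * w j l b ∈ LinearMap.range (w k l) := by
    refine hind _ (hclosed (w k i a) (w j l b) (LinearMap.range (w k l))
      (by rw [LinearMap.coe_range]; exact (hiso k l).isClosedEmbedding.isClosed_range))
      (fun c m n => ?_) T
    change w k i a * w m n c * w j l b ∈ LinearMap.range (w k l)
    rw [hmul]
    split_ifs
    · rw [hmul]
      split_ifs
      · exact ⟨_, rfl⟩
      · exact zero_mem _
    · rw [zero_mul]
      exact zero_mem _
  have hJ : ∀ i j, ∀ x, x ≠ 0 → w i j x ∈ I → ∀ y, w i j y ∈ I := by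
    intro i j x hx0 hx y
    have hid : IsIdeal (I.comap (w i j)) := by
      intro x y hy
      constructor
      · have := hmul x y i i i j
        rw [if_pos rfl] at this
        rw [Submodule.mem_comap, ← this]
        exact (hI _ _ hy).1
      · have := hmul y x i j j j
        rw [if_pos rfl] at this
        rw [Submodule.mem_comap, ← this]
        exact (hI _ _ hy).2
    rcases hA _ hid (hcl.preimage (hiso i j).continuous) with h | h
    · exact absurd ((Submodule.mem_bot ℂ).1 (h ▸ Submodule.mem_comap.2 hx)) hx0
    · have : y ∈ I.comap (w i j) := h ▸ Submodule.mem_top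
      exact this
  have hkl := hJ k l c (fun h => hne0 (by rw [← hc, h, map_zero]))
    (hc ▸ (hI _ _ (hI _ _ hTI).1).2)
  -- This element moves the ideal from position `(k, l)` to `(i, j)`: it is the coefficient of `w i
  -- k c * w k l (star c) * w l j c`.
  have hc0 : c * star c * c ≠ 0 := by
    intro h
    have h1 : star (star c * c) * (star c * c) = 0 := by
      rw [star_mul, star_star, mul_assoc, ← mul_assoc c, h, mul_zero]
    exact hne0 (by rw [← hc, CStarRing.star_mul_self_eq_zero_iff _ |>.1
      (CStarRing.star_mul_self_eq_zero_iff _ |>.1 h1), map_zero])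
  refine Submodule.eq_top_iff'.2 (hind I hcl fun y i j => hJ i j _ hc0 ?_ y)
  have h1 := hmul c (star c) i k k l
  have h2 := hmul (c * star c) c i l l j
  rw [if_pos rfl] at h1 h2
  rw [← h2, ← h1]
  exact (hI _ _ (hI _ _ (hkl _)).1).2

end MatrixUnits

/-! ### Simplicity of the stabilization. -/

section Stabilization

variable {A : Type u} [NonUnitalCStarAlgebra A] [PartialOrder A] [StarOrderedRing A]

theorem univRep_apply_apply (a : A) (ξ : UnivSpace A) (f : A →ₚ[ℂ] ℂ) :
    univRep a ξ f = f.gnsNonUnitalStarAlgHom a (ξ f) := rfl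

variable (A) in
/-- The universal representation as a ⋆-homomorphism. -/
noncomputable def univHom : A →⋆ₙₐ[ℂ] (UnivSpace A →L[ℂ] UnivSpace A) where
  toFun := univRep
  map_smul' c a := by
    ext ξ f
    change f.gnsNonUnitalStarAlgHom (c • a) (ξ f) = c • f.gnsNonUnitalStarAlgHom a (ξ f)
    rw [map_smul]
    rfl
  map_zero' := by
    ext ξ f
    change f.gnsNonUnitalStarAlgHom 0 (ξ f) = 0
    rw [map_zero]
    rfl
  map_add' a b := by
    ext ξ f
    change f.gnsNonUnitalStarAlgHom (a + b) (ξ f) =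
      f.gnsNonUnitalStarAlgHom a (ξ f) + f.gnsNonUnitalStarAlgHom b (ξ f)
    rw [map_add]
    rfl
  map_mul' a b := by
    ext ξ f
    change f.gnsNonUnitalStarAlgHom (a * b) (ξ f) =
      f.gnsNonUnitalStarAlgHom a (f.gnsNonUnitalStarAlgHom b (ξ f))
    rw [map_mul]
    rfl
  map_star' a := by
    rw [ContinuousLinearMap.star_eq_adjoint, ContinuousLinearMap.eq_adjoint_iff]
    intro ξ η
    rw [lp.inner_eq_tsum, lp.inner_eq_tsum]
    refine tsum_congr fun f => ?_
    rw [univRep_apply_apply, univRep_apply_apply, map_star, ContinuousLinearMap.star_eq_adjoint,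
      ContinuousLinearMap.adjoint_inner_left]

theorem tensorUnit_apply (a : A) (i j : ℕ) (x : AmplifiedSpace A) :
    tensorUnit a i j x = lp.single 2 i (univRep a (x j)) := rfl

theorem tensorUnit_mul (a b : A) (i j k l : ℕ) :
    tensorUnit a i j * tensorUnit b k l = if j = k then tensorUnit (a * b) i l else 0 := by
  refine ContinuousLinearMap.ext fun x => ?_
  rw [mul_apply_eq_comp, tensorUnit_apply, tensorUnit_apply]
  split_ifs with h
  · subst h
    rw [lp.single_apply_self, tensorUnit_apply]
    congr 1
    exact (DFunLike.congr_fun (map_mul (univHom A) a b) _).symm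
  · rw [lp.single_apply_ne _ _ _ h, map_zero]
    ext n : 2
    simp

theorem star_tensorUnit (a : A) (i j : ℕ) :
    star (tensorUnit a i j) = tensorUnit (star a) j i := by
  rw [ContinuousLinearMap.star_eq_adjoint]
  symm
  rw [ContinuousLinearMap.eq_adjoint_iff]
  intro x y
  rw [tensorUnit_apply, tensorUnit_apply, lp.inner_single_left, lp.inner_single_right]
  have : univRep (star a) = star (univRep a) := map_star (univHom A) a
  rw [this, ContinuousLinearMap.star_eq_adjoint, ContinuousLinearMap.adjoint_inner_left]

theorem norm_tensorUnit (a : A) (i j : ℕ) : ‖tensorUnit a i j‖ = ‖univRep a‖ := by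
  refine le_antisymm ?_ ?_
  · refine ContinuousLinearMap.opNorm_le_bound _ (norm_nonneg _) fun x => ?_
    rw [tensorUnit_apply, lp.norm_single (by norm_num)]
    exact (ContinuousLinearMap.le_opNorm _ _).trans
      (mul_le_mul_of_nonneg_left (lp.norm_apply_le_norm (by norm_num) x j) (norm_nonneg _))
  · refine ContinuousLinearMap.opNorm_le_bound _ (norm_nonneg _) fun ξ => ?_
    have := (tensorUnit a i j).le_opNorm (lp.single 2 j ξ)
    rwa [tensorUnit_apply, lp.single_apply_self, lp.norm_single (by norm_num),
      lp.norm_single (by norm_num)] at this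

theorem tensorUnit_mem (a : A) (i j : ℕ) : tensorUnit a i j ∈ stabSubalgebra A :=
  NonUnitalStarSubalgebra.le_topologicalClosure _
    (NonUnitalStarAlgebra.subset_adjoin _ _ ⟨a, i, j, rfl⟩)

/-- The elementary tensor `a ⊗ e_{i,j}` as an element of the stabilization, as a linear map. -/
noncomputable def stabUnit (i j : ℕ) : A →ₗ[ℂ] Stab A where
  toFun a := (⟨tensorUnit a i j, tensorUnit_mem a i j⟩ : stabSubalgebra A)
  map_add' a b := by
    refine Subtype.ext (ContinuousLinearMap.ext fun x => ?_)
    change lp.single (E := fun _ : ℕ => UnivSpace A) 2 i (univHom A (a + b) (x j)) =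
      lp.single 2 i (univHom A a (x j)) + lp.single 2 i (univHom A b (x j))
    rw [map_add, add_apply, lp.single_add]
  map_smul' c a := by
    refine Subtype.ext (ContinuousLinearMap.ext fun x => ?_)
    change lp.single (E := fun _ : ℕ => UnivSpace A) 2 i (univHom A (c • a) (x j)) =
      c • lp.single 2 i (univHom A a (x j))
    rw [map_smul, smul_apply, lp.single_smul]

theorem stabUnit_mul (a b : A) (i j k l : ℕ) :
    stabUnit i j a * stabUnit k l b = if j = k then stabUnit i l (a * b) else 0 := by
  refine Subtype.ext ((tensorUnit_mul a b i j k l).trans ?_)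
  split_ifs <;> rfl

theorem norm_stabUnit (a : A) (i j : ℕ) : ‖stabUnit i j a‖ = ‖univHom A a‖ :=
  norm_tensorUnit a i j

/-- Together with 0, the elementary tensors are closed under products and adjoints, so their span is
already a ⋆-algebra. -/
theorem adjoin_tensorUnit_le :
    (NonUnitalStarAlgebra.adjoin ℂ
      {T | ∃ (a : A) (i j : ℕ), T = tensorUnit a i j}).toSubmodule ≤
    Submodule.span ℂ {T | ∃ (a : A) (i j : ℕ), T = tensorUnit a i j} := by
  rw [NonUnitalStarAlgebra.adjoin_eq_span, Submodule.span_le]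
  intro T hT
  have h : T = 0 ∨ ∃ (a : A) (i j : ℕ), T = tensorUnit a i j := by
    induction hT using Subsemigroup.closure_induction with
    | mem T hT =>
      rcases hT with h | ⟨a, i, j, h⟩
      · exact Or.inr h
      · exact Or.inr ⟨star a, j, i, by rw [← star_tensorUnit, ← h, star_star]⟩
    | mul S T _ _ hS hT =>
      rcases hS with rfl | ⟨a, i, j, rfl⟩
      · exact Or.inl (zero_mul _)
      rcases hT with rfl | ⟨b, k, l, rfl⟩
      · exact Or.inl (mul_zero _)
      rw [tensorUnit_mul]
      split_ifs
      · exact Or.inr ⟨_, _, _, rfl⟩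
      · exact Or.inl rfl
  rcases h with rfl | h
  · exact zero_mem _
  · exact Submodule.subset_span h

variable (A) in
/-- The inclusion of the stabilization into the bounded operators. -/
noncomputable def stabVal : Stab A →ₗ[ℂ] AmplifiedSpace A →L[ℂ] AmplifiedSpace A :=
  (stabSubalgebra A).toSubmodule.subtype

theorem dense_span_stabUnit :
    Dense (Submodule.span ℂ {x : Stab A | ∃ a i j, x = stabUnit i j a} : Set (Stab A)) := by
  intro x
  have hind : Topology.IsInducing (stabVal A) := Topology.IsInducing.subtypeVal
  rw [hind.closure_eq_preimage_closure_image, Set.mem_preimage, ← Submodule.map_coe,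
    Submodule.map_span]
  have h1 : stabVal A '' {x : Stab A | ∃ a i j, x = stabUnit i j a} =
      {T | ∃ (a : A) (i j : ℕ), T = tensorUnit a i j} := by
    ext T
    constructor
    · rintro ⟨_, ⟨a, i, j, rfl⟩, rfl⟩
      exact ⟨a, i, j, rfl⟩
    · rintro ⟨a, i, j, rfl⟩
      exact ⟨_, ⟨a, i, j, rfl⟩, rfl⟩
  rw [h1]
  have h2 : stabVal A x ∈ closure ((NonUnitalStarAlgebra.adjoin ℂ
      {T | ∃ (a : A) (i j : ℕ), T = tensorUnit a i j} :
        NonUnitalStarSubalgebra ℂ (AmplifiedSpace A →L[ℂ] AmplifiedSpace A)) : Set _) := x.2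
  exact closure_mono adjoin_tensorUnit_le h2

/-- The stabilization of a simple C⋆-algebra is simple. -/
theorem isSimple_stab (hA : IsSimple A) : IsSimple (Stab A) := by
  -- The kernel of the universal representation is 0 or `A` by simplicity. In the first case the
  -- matrix units are isometric; in the second the stabilization is zero.
  let J : Submodule ℂ A :=
    { carrier := {a | univHom A a = 0}
      add_mem' := fun {a b} ha hb => by
        simp only [Set.mem_ofPred_eq] at ha hb ⊢
        rw [map_add, ha, hb, add_zero]
      zero_mem' := map_zero _
      smul_mem' := fun c a ha => by
        simp only [Set.mem_ofPred_eq] at ha ⊢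
        rw [map_smul, ha, smul_zero] }
  have hJmem : ∀ a, a ∈ J ↔ univHom A a = 0 := fun a => Iff.rfl
  have hcont : Continuous (univHom A) :=
    AddMonoidHomClass.continuous_of_bound (univHom A) 1 fun a => by
      rw [one_mul]
      exact NonUnitalStarAlgHom.norm_apply_le (univHom A) a
  have hJ : IsIdeal J := fun x y hy => by
    rw [hJmem] at hy
    rw [hJmem, hJmem, map_mul, map_mul, hy, mul_zero, zero_mul]
    exact ⟨rfl, rfl⟩
  rcases hA J hJ (isClosed_singleton.preimage hcont) with h | h
  · have hinj : Function.Injective (univHom A) := by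
      rw [injective_iff_map_eq_zero]
      intro a ha
      have : a ∈ J := ha
      rwa [h, Submodule.mem_bot] at this
    refine hA.of_matrixUnits stabUnit stabUnit_mul (fun i j => ?_) dense_span_stabUnit
    exact AddMonoidHomClass.isometry_of_norm _ fun a => by
      rw [norm_stabUnit, NonUnitalStarAlgHom.norm_map _ hinj]
  · intro I _ _
    left
    have h0 : ∀ a i j, stabUnit (A := A) i j a = 0 := fun a i j => by
      have : a ∈ J := h ▸ Submodule.mem_top
      rw [← norm_eq_zero, norm_stabUnit, (hJmem a).1 this, norm_zero]
    have h1 : Submodule.span ℂ {x : Stab A | ∃ a i j, x = stabUnit i j a} = ⊥ := by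
      rw [Submodule.span_eq_bot]
      rintro _ ⟨a, i, j, rfl⟩
      exact h0 a i j
    rw [eq_bot_iff]
    intro x _
    have := dense_span_stabUnit x
    rw [h1, Submodule.bot_coe, closure_singleton] at this
    exact this

end Stabilization

/-! ### Affine maps of Bauer simplices in product spaces. -/

section AffineMaps

variable {I : Type u}

/-- A continuous map from the extremal boundary of a Bauer simplex into a closed convex set extends
to a continuous affine map of the simplex. -/
theorem IsBauerSimplex.exists_affine_map {S T : Set (I → ℂ)} (hS : IsBauerSimplex S)
    (hne : S.Nonempty) (hTcl : IsClosed T) (hTc : Convex ℝ T)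
    {f : S.extremePoints ℝ → I → ℂ} (hf : Continuous f) (hfT : ∀ k, f k ∈ T) :
    ∃ Γ : (I → ℂ) → I → ℂ, ContinuousOn Γ S ∧
      (∀ x ∈ S, ∀ y ∈ S, ∀ a b : ℝ, 0 ≤ a → 0 ≤ b → a + b = 1 →
        Γ (a • x + b • y) = a • Γ x + b • Γ y) ∧
      (∀ k : S.extremePoints ℝ, Γ k = f k) ∧ Set.MapsTo Γ S T := by
  choose F hF hFe using fun i => hS.exists_affine_extension hne
    ⟨fun k => (f k i).re, Complex.continuous_re.comp ((continuous_apply i).comp hf)⟩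
  choose G hG hGe using fun i => hS.exists_affine_extension hne
    ⟨fun k => (f k i).im, Complex.continuous_im.comp ((continuous_apply i).comp hf)⟩
  let Γ : (I → ℂ) → I → ℂ := fun x i => ⟨F i x, G i x⟩
  have hcont : ContinuousOn Γ S := by
    refine continuousOn_pi.2 fun i => ?_
    have h : ∀ x, Γ x i = Complex.equivRealProdCLM.symm (F i x, G i x) := fun x => rfl
    simp only [h]
    exact Complex.equivRealProdCLM.symm.continuous.comp_continuousOn ((hF i).1.prodMk (hG i).1)
  have haff : ∀ x ∈ S, ∀ y ∈ S, ∀ a b : ℝ, 0 ≤ a → 0 ≤ b → a + b = 1 →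
      Γ (a • x + b • y) = a • Γ x + b • Γ y := by
    intro x hx y hy a b ha hb hab
    funext i
    refine Complex.ext ?_ ?_
    · simpa [Γ] using (hF i).2 x hx y hy a b ha hb hab
    · simpa [Γ] using (hG i).2 x hx y hy a b ha hb hab
  have hext : ∀ k : S.extremePoints ℝ, Γ k = f k := fun k => by
    funext i
    exact Complex.ext (hFe i k) (hGe i k)
  refine ⟨Γ, hcont, haff, hext, ?_⟩
  refine forall_mem_of_extremePoints hS.isCompact hS.convex
    (hcont.preimage_isClosed_of_isClosed hS.isCompact.isClosed hTcl) ?_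
    fun x hx => by rw [hext ⟨x, hx⟩]; exact hfT _
  rintro x ⟨hx, hx'⟩ y ⟨hy, hy'⟩ a b ha hb hab
  refine ⟨hS.convex hx hy ha hb hab, ?_⟩
  rw [haff x hx y hy a b ha hb hab]
  exact hTc hx' hy' ha hb hab

/-- A continuous affine self-map of a compact convex set that fixes the extreme points is the
identity. -/
theorem eq_of_affine_of_extremePoints {S : Set (I → ℂ)} (hS : IsCompact S) (hc : Convex ℝ S)
    {Γ : (I → ℂ) → I → ℂ} (hcont : ContinuousOn Γ S)
    (haff : ∀ x ∈ S, ∀ y ∈ S, ∀ a b : ℝ, 0 ≤ a → 0 ≤ b → a + b = 1 →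
      Γ (a • x + b • y) = a • Γ x + b • Γ y)
    (hext : ∀ k ∈ S.extremePoints ℝ, Γ k = k) : ∀ x ∈ S, Γ x = x := by
  refine forall_mem_of_extremePoints hS hc ?_ ?_ hext
  · have := (hcont.sub continuousOn_id).preimage_isClosed_of_isClosed hS.isClosed
      (isClosed_singleton (x := 0))
    convert! this using 1
    ext x
    simp [sub_eq_zero]
  · rintro x ⟨hx, hx'⟩ y ⟨hy, hy'⟩ a b ha hb hab
    exact ⟨hc hx hy ha hb hab, by rw [haff x hx y hy a b ha hb hab, hx', hy']⟩

/-- A perspectivity of Bauer simplices agrees on the extremal boundary with an affine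
homeomorphism. -/
theorem IsPerspective.exists_affine_homeomorph {S T : Set (I → ℂ)} {g h : (I → ℂ) → ℝ}
    (H : IsPerspective S T g h) (hS : IsBauerSimplex S) (hne : S.Nonempty) :
    ∃ γ : S ≃ₜ T,
      (∀ (x y z : S) (a b : ℝ), 0 ≤ a → 0 ≤ b → a + b = 1 → z.1 = a • x.1 + b • y.1 →
        (γ z).1 = a • (γ x).1 + b • (γ y).1) ∧
      ∀ τ : S, τ.1 ∈ S.extremePoints ℝ → (γ τ).1 = (g τ)⁻¹ • τ.1 := by
  have hT := H.isBauerSimplex hS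
  have hneT : T.Nonempty := hne.elim fun x hx => ⟨_, H.mapsTo_left x hx⟩
  obtain ⟨Γ, hΓc, hΓa, hΓe, hΓm⟩ := hS.exists_affine_map hne hT.isCompact.isClosed hT.convex
    (continuous_subtype_val.comp H.extremeHomeomorph.continuous)
    fun k => (H.extremeHomeomorph k).2.1
  obtain ⟨Δ, hΔc, hΔa, hΔe, hΔm⟩ := hT.exists_affine_map hneT hS.isCompact.isClosed hS.convex
    (continuous_subtype_val.comp H.extremeHomeomorph.symm.continuous)
    fun k => (H.extremeHomeomorph.symm k).2.1
  -- Each composite of the two affine extensions fixes the extreme points, hence is the identity.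
  have hΔΓ := eq_of_affine_of_extremePoints (Γ := fun x => Δ (Γ x)) hS.isCompact hS.convex
    (hΔc.comp hΓc hΓm)
    (fun x hx y hy a b ha hb hab => by
      rw [hΓa x hx y hy a b ha hb hab, hΔa _ (hΓm hx) _ (hΓm hy) a b ha hb hab])
    fun k hk => by
      have h1 := hΓe ⟨k, hk⟩
      have h2 := hΔe (H.extremeHomeomorph ⟨k, hk⟩)
      simp only [Function.comp_apply, Homeomorph.symm_apply_apply] at h1 h2
      rw [h1, h2]
  have hΓΔ := eq_of_affine_of_extremePoints (Γ := fun x => Γ (Δ x)) hT.isCompact hT.convex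
    (hΓc.comp hΔc hΔm)
    (fun x hx y hy a b ha hb hab => by
      rw [hΔa x hx y hy a b ha hb hab, hΓa _ (hΔm hx) _ (hΔm hy) a b ha hb hab])
    fun k hk => by
      have h1 := hΔe ⟨k, hk⟩
      have h2 := hΓe (H.extremeHomeomorph.symm ⟨k, hk⟩)
      simp only [Function.comp_apply, Homeomorph.apply_symm_apply] at h1 h2
      rw [h1, h2]
  refine ⟨
    { toFun := fun x => ⟨Γ x, hΓm x.2⟩
      invFun := fun y => ⟨Δ y, hΔm y.2⟩
      left_inv := fun x => Subtype.ext (hΔΓ x x.2)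
      right_inv := fun y => Subtype.ext (hΓΔ y y.2)
      continuous_toFun := (continuousOn_iff_continuous_domRestrict.1 hΓc).subtype_mk _
      continuous_invFun := (continuousOn_iff_continuous_domRestrict.1 hΔc).subtype_mk _ },
    fun x y z a b ha hb hab hz => ?_, fun τ hτ => hΓe ⟨τ, hτ⟩⟩
  change Γ z = a • Γ x + b • Γ y
  rw [hz, hΓa x x.2 y y.2 a b ha hb hab]

end AffineMaps

/-! ### Bases of the cone of traces. -/

section Bases

variable {B : Type u} [NonUnitalCStarAlgebra B]

/-- Evaluating at `e` forces the scalar to be `t(e)`, which is positive by faithfulness. -/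
theorem isTraceBasis_tracesAt (hB : IsSimple B) {e : ped B} (he0 : e ≠ 0)
    (he : IsPos (e : B)) : IsTraceBasis (tracesAt e) := by
  refine ⟨fun τ hτ => ⟨hτ.1, fun h0 => ?_⟩, fun τ hτ σ hσ a b ha hb hab => ⟨?_, ?_⟩,
    fun t ht => ?_⟩
  · have := hτ.2
    rw [Set.mem_singleton_iff.1 h0] at this
    exact zero_ne_one this
  · exact add_mem_traces (smul_mem_traces hτ.1 ha) (smul_mem_traces hσ.1 hb)
  · simp only [Pi.add_apply, Pi.smul_apply, hτ.2, hσ.2, ← add_smul, hab, one_smul]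
  · have hpos := trace_re_pos hB ht he0 he
    have heq := trace_apply_eq_re ht.1 he
    refine ⟨((t e).re, (t e).re⁻¹ • t), ⟨hpos.le, ⟨smul_mem_traces ht.1 (by positivity), ?_⟩,
      smul_inv_smul₀ hpos.ne' t⟩, ?_⟩
    · change ((t e).re⁻¹ • t) e = 1
      rw [Pi.smul_apply, heq, Complex.ofReal_re, Complex.real_smul, ← Complex.ofReal_mul,
        inv_mul_cancel₀ hpos.ne', Complex.ofReal_one]
    · rintro ⟨r, s⟩ ⟨hr, hs, hrs⟩
      simp only at hr hs hrs
      have h1 : (t e).re = r := by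
        rw [← hrs, Pi.smul_apply, hs.2]
        simp
      have h2 : s = (t e).re⁻¹ • t := by
        rw [h1, ← hrs, inv_smul_smul₀ (h1 ▸ hpos.ne')]
      rw [h2, h1]

/-- A compact basis of the cone of traces of a simple C⋆-algebra corresponds to the basis of the
traces that are normalized at `e`. -/
theorem IsTraceBasis.exists_isPerspective (hB : IsSimple B) {S : Set (ped B → ℂ)}
    (hS : IsCompact S) (hbasis : IsTraceBasis S) {e : ped B} (he0 : e ≠ 0)
    (he : IsPos (e : B)) :
    ∃ h, IsPerspective S (tracesAt e) (fun τ => (τ e).re) h := by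
  have hT := isTraceBasis_tracesAt hB he0 he
  have hex : ∀ t ∈ traces B \ {0}, ∃ r : ℝ, 0 < r ∧ r⁻¹ • t ∈ S := by
    intro t ht
    obtain ⟨⟨r, s⟩, ⟨hr, hs, hrs⟩, -⟩ := hbasis.2.2 t ht
    simp only at hr hs hrs
    have hr0 : r ≠ 0 := by
      rintro rfl
      rw [zero_smul] at hrs
      exact ht.2 hrs.symm
    exact ⟨r, hr.lt_of_ne' hr0, by rwa [← hrs, inv_smul_smul₀ hr0]⟩
  choose! h hpos hmem using hex
  have huniq : ∀ t ∈ traces B \ {0}, ∀ r : ℝ, 0 < r → r⁻¹ • t ∈ S → h t = r := by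
    intro t ht r hr hrS
    have := (hbasis.2.2 t ht).unique (y₁ := (h t, (h t)⁻¹ • t)) (y₂ := (r, r⁻¹ • t))
      ⟨(hpos t ht).le, hmem t ht, smul_inv_smul₀ (hpos t ht).ne' t⟩
      ⟨hr.le, hrS, smul_inv_smul₀ hr.ne' t⟩
    exact congrArg Prod.fst this
  have gpos : ∀ x ∈ S, 0 < (x e).re := fun x hx => trace_re_pos hB (hbasis.1 hx) he0 he
  have gmem : ∀ x ∈ S, ((x e).re)⁻¹ • x ∈ tracesAt e := by
    intro x hx
    have hx' := (hbasis.1 hx).1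
    refine ⟨smul_mem_traces hx' (inv_nonneg.2 (gpos x hx).le), ?_⟩
    rw [Pi.smul_apply, trace_apply_eq_re hx' he, Complex.ofReal_re, Complex.real_smul,
      ← Complex.ofReal_mul, inv_mul_cancel₀ (gpos x hx).ne', Complex.ofReal_one]
  have happ : ∀ x ∈ S, h (((x e).re)⁻¹ • x) = ((x e).re)⁻¹ := by
    intro x hx
    have hp := gpos x hx
    refine huniq _ (hT.1 (gmem x hx)) _ (inv_pos.2 hp) ?_
    rwa [inv_inv, smul_inv_smul₀ hp.ne']
  have hinv : ∀ y ∈ tracesAt e, (((h y)⁻¹ • y) e).re = (h y)⁻¹ := by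
    intro y hy
    rw [Pi.smul_apply, hy.2]
    simp
  have hgc : Continuous fun τ : ped B → ℂ => (τ e).re :=
    Complex.continuous_re.comp (continuous_apply e)
  -- The projection `E` is a continuous bijection from a compact space to a Hausdorff one, so `E⁻¹`
  -- is continuous, and `h y` is the reciprocal of `E⁻¹ y` evaluated at `e`.
  have hcont : ContinuousOn h (tracesAt e) := by
    have := isCompact_iff_compactSpace.1 hS
    let E : S ≃ tracesAt e :=
      { toFun := fun x => ⟨((x.1 e).re)⁻¹ • x.1, gmem x x.2⟩
        invFun := fun y => ⟨(h y)⁻¹ • y.1, hmem y (hT.1 y.2)⟩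
        left_inv := fun x => Subtype.ext (by
          change (h (((x.1 e).re)⁻¹ • x.1))⁻¹ • ((x.1 e).re)⁻¹ • x.1 = x.1
          rw [happ x x.2, inv_inv, smul_inv_smul₀ (gpos x x.2).ne'])
        right_inv := fun y => Subtype.ext (by
          change ((((h y.1)⁻¹ • y.1) e).re)⁻¹ • (h y.1)⁻¹ • y.1 = y.1
          rw [hinv y y.2, inv_inv, smul_inv_smul₀ (hpos y (hT.1 y.2)).ne']) }
    have hE : Continuous E :=
      (((hgc.comp continuous_subtype_val).inv₀ fun x => (gpos x x.2).ne').smul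
        continuous_subtype_val).subtype_mk _
    have h1 := (hE.homeoOfEquivCompactToT2).symm.continuous
    rw [continuousOn_iff_continuous_domRestrict]
    have h2 : (tracesAt e).domRestrict h = fun y => (((E.symm y).1 e).re)⁻¹ := by
      funext y
      change h y = ((((h y.1)⁻¹ • y.1) e).re)⁻¹
      rw [hinv y y.2, inv_inv]
    rw [h2]
    exact (hgc.comp (continuous_subtype_val.comp h1)).inv₀ fun y => (gpos _ (E.symm y).2).ne'
  refine ⟨h, hbasis.2.1, hT.2.1, gpos, fun y hy => hpos y (hT.1 hy), ⟨hgc.continuousOn, ?_⟩,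
    ⟨hcont, ?_⟩, gmem, fun y hy => hmem y (hT.1 hy), happ, hinv⟩
  · intro x _ y _ a b _ _ _
    simp
  · intro x hx y hy a b ha hb hab
    have px := hpos x (hT.1 hx)
    have py := hpos y (hT.1 hy)
    have hp : 0 < a * h x + b * h y := by
      rcases ha.eq_or_lt with rfl | ha
      · obtain rfl : b = 1 := by linarith
        linarith
      · positivity
    -- By uniqueness of the scalar, affinity of `h` reduces to showing that `a • x + b • y` divided
    -- by `a h(x) + b h(y)` lies in `S`; it is a convex combination of the projections of `x` and
    -- `y`.
    refine huniq _ (hT.1 (hT.2.1 hx hy ha hb hab)) _ hp ?_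
    have : (a * h x / (a * h x + b * h y)) • (h x)⁻¹ • x +
        (b * h y / (a * h x + b * h y)) • (h y)⁻¹ • y ∈ S := hbasis.2.1
      (hmem x (hT.1 hx)) (hmem y (hT.1 hy)) (by positivity) (by positivity) (by rw [← add_div, div_self hp.ne'])
    convert! this using 1
    rw [smul_add, smul_smul, smul_smul, smul_smul, smul_smul]
    congr 2 <;> field_simp

theorem inv_smul_trace_apply {τ : ped B → ℂ} (hτ : τ ∈ traces B) {e : ped B}
    (he : IsPos (e : B)) (a : ped B) : (((τ e).re)⁻¹ • τ) a = τ a / τ e := by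
  rw [Pi.smul_apply, Complex.real_smul, Complex.ofReal_inv, ← trace_apply_eq_re hτ he,
    inv_mul_eq_div]

end Bases

end TraceCone

/-! ### The main theorem. -/

theorem proposition2p5 {A : Type u} [NonUnitalCStarAlgebra A] [PartialOrder A] [StarOrderedRing A]
    [TopologicalSpace.SeparableSpace A] (hA : TraceCone.IsSimple A)
    (hne : (TraceCone.traces (TraceCone.Stab A) \ {0}).Nonempty)
    (S : Set (TraceCone.ped (TraceCone.Stab A) → ℂ))
    (hS : TraceCone.IsChoquetSimplex S) (hbasis : TraceCone.IsTraceBasis S)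
    (e : TraceCone.ped (TraceCone.Stab A)) (he0 : e ≠ 0)
    (hepos : TraceCone.IsPos (e : TraceCone.Stab A)) (hele : ‖(e : TraceCone.Stab A)‖ ≤ 1) :
    -- `T_e` is a Choquet simplex and a basis of the cone of traces
    TraceCone.IsChoquetSimplex (TraceCone.tracesAt e) ∧
    TraceCone.IsTraceBasis (TraceCone.tracesAt e) ∧
    -- (1)
    (∃ γ : S ≃ₜ TraceCone.tracesAt e,
      (∀ (τ : S) (a : TraceCone.ped (TraceCone.Stab A)), (γ τ).1 a = τ.1 a / τ.1 e) ∧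
      γ '' {τ | τ.1 ∈ S.extremePoints ℝ} =
        {t | t.1 ∈ (TraceCone.tracesAt e).extremePoints ℝ}) ∧
    -- (2), and independence of the basis
    (TraceCone.ConditionC S ↔ TraceCone.ConditionC (TraceCone.tracesAt e)) ∧
    (∀ S' : Set (TraceCone.ped (TraceCone.Stab A) → ℂ),
      TraceCone.IsChoquetSimplex S' → TraceCone.IsTraceBasis S' →
        (TraceCone.ConditionC S ↔ TraceCone.ConditionC S')) ∧
    -- (3)
    (TraceCone.IsBauerSimplex S →
      TraceCone.IsBauerSimplex (TraceCone.tracesAt e) ∧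
      ∃ γ : S ≃ₜ TraceCone.tracesAt e,
        (∀ (x y z : S) (a b : ℝ), 0 ≤ a → 0 ≤ b → a + b = 1 → z.1 = a • x.1 + b • y.1 →
          (γ z).1 = a • (γ x).1 + b • (γ y).1) ∧
        ∀ τ : S, τ.1 ∈ S.extremePoints ℝ →
          ∀ a : TraceCone.ped (TraceCone.Stab A), (γ τ).1 a = τ.1 a / τ.1 e) := by
  have hB := TraceCone.isSimple_stab hA
  obtain ⟨h, H⟩ := hbasis.exists_isPerspective hB hS.isCompact he0 hepos
  have hT := H.isChoquetSimplex hS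
  have hSne : S.Nonempty := by
    obtain ⟨t, ht⟩ := hne
    obtain ⟨p, hp, -⟩ := hbasis.2.2 t ht
    exact ⟨p.2, hp.2.1⟩
  -- Stated for an arbitrary basis, so that `S` and `S'` can be compared through `T_e`.
  have hC : ∀ S' : Set (TraceCone.ped (TraceCone.Stab A) → ℂ),
      TraceCone.IsChoquetSimplex S' → TraceCone.IsTraceBasis S' →
        (TraceCone.ConditionC S' ↔ TraceCone.ConditionC (TraceCone.tracesAt e)) := by
    intro S' hS' hb'
    obtain ⟨h', H'⟩ := hb'.exists_isPerspective hB hS'.isCompact he0 hepos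
    exact ⟨H'.conditionC hS'.isCompact.isClosed hT.isCompact.isClosed,
      H'.symm.conditionC hT.isCompact.isClosed hS'.isCompact.isClosed⟩
  refine ⟨hT, TraceCone.isTraceBasis_tracesAt hB he0 hepos, ⟨H.homeomorph, fun τ a =>
    TraceCone.inv_smul_trace_apply (hbasis.1 τ.2).1 hepos a, ?_⟩, hC S hS hbasis,
    fun S' hS' hb' => (hC S hS hbasis).trans (hC S' hS' hb').symm, fun hbauer =>
    ⟨H.isBauerSimplex hbauer, ?_⟩⟩
  · ext t
    constructor
    · rintro ⟨τ, hτ, rfl⟩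
      exact H.mem_extremePoints hτ
    · intro ht
      exact ⟨H.homeomorph.symm t, H.symm.mem_extremePoints ht, H.homeomorph.apply_symm_apply t⟩
  · obtain ⟨γ, hγ, hγe⟩ := H.exists_affine_homeomorph hbauer hSne
    refine ⟨γ, hγ, fun τ hτ a => ?_⟩
    rw [hγe τ hτ]
    exact TraceCone.inv_smul_trace_apply (hbasis.1 τ.2).1 hepos a
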